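/- Let $(X,d)$ be a geodesic metric space, let $o\in X$, and let $G$ be a countable (discrete) group acting on $X$ by isometries. **Definitions.** For $A\subseteq X$ and $x\in X$ let $\pi_A(x)=\{a\in A: d(x,a)=d(x,A)\}$. For $K>0$, $A$ is $K$-contracting if $\pi_A(z)\neq\emptyset$ for all $z\in X$, and $\operatorname{diam}(\pi_A(x)\cup\pi_A(y))\le K$ whenever $x,y\in X$ satisfy $d(x,y)\le d(x,A)-K$. An element $g\in G$ is contracting if for some $K>0$ the set $\{g^n o: n\in\mathbb Z\}$ is $K$-contracting and $n\mapsto g^n o$ is a $K$-quasigeodesic, i.e. $\frac1K|m-n|-K\le d(g^m o,g^n o)\le K|m-n|+K$ for all $m,n\in\mathbb Z$. Two elements $g,h\in G$ are independent if for every $M>0$ the set $\{(n,m)\in\mathbb Z^2: d(g^n o,h^m o)<M\}$ is bounded. A probability measure $\mu$ on $G$ is non-elementary if the semigroup $\{g_1\cdots g_n: n\ge 0,\ \mu(\{g_i\})>0 \text{ for all } i\}$ contains two independent contracting elements. It has finite first moment if $\int_G d(o,go)\,d\mu(g)<\infty$. **Theorem 1.4 (SLLN).** Let $\mu$ be a non-elementary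 probability measure on $G$, and let $(w_n)_{n\in\mathbb Z}$ be the random walk it generates: $w_n=g_1\cdots g_n$ for $n\ge 0$ and $w_n=g_0^{-1}g_{-1}^{-1}\cdots g_{n+1}^{-1}$ for $n<0$, where $(g_i)_{i\in\mathbb Z}$ has law $\mu^{\mathbb Z}$. Then there exists a constant $\lambda\in(0,+\infty]$ such that $$\lim_{n\to+\infty}\frac1n\,d(o,w_n o)=\lambda\qquad\text{for almost every }(g_i)_{i\in\mathbb Z}.$$ Moreover, $\lambda$ is finite if and only if $\mu$ has finite first moment. -/

import Mathlib

open MeasureTheory Filter Topology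
open scoped ENNReal

namespace ContractingWalk

/-- Every two points of `X` are joined by a geodesic segment. -/
def IsGeodesicSpace (X : Type*) [MetricSpace X] : Prop :=
  ∀ x y : X, ∃ γ : ℝ → X, γ 0 = x ∧ γ (dist x y) = y ∧
    ∀ s ∈ Set.Icc 0 (dist x y), ∀ t ∈ Set.Icc 0 (dist x y), dist (γ s) (γ t) = |s - t|

section Paths

variable {X : Type*} [MetricSpace X]

/-- The closest point projection `π_A(x)`, a (possibly empty) set of points of `A`. -/
def proj (A : Set X) (x : X) : Set X :=
  {a ∈ A | dist x a = Metric.infDist x A}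

/-- `K`-contracting subsets; the last clause says that the diameter of `π_A(x) ∪ π_A(y)`
is at most `K`. -/
def IsContractingSet (K : ℝ) (A : Set X) : Prop :=
  (∀ z : X, (proj A z).Nonempty) ∧
    ∀ x y : X, dist x y ≤ Metric.infDist x A - K →
      ∀ a ∈ proj A x ∪ proj A y, ∀ b ∈ proj A x ∪ proj A y, dist a b ≤ K

/-- Bi-infinite discrete `K`-quasigeodesics. -/
def IsQuasigeodesic (K : ℝ) (γ : ℤ → X) : Prop :=
  ∀ m n : ℤ, |(m : ℝ) - n| / K - K ≤ dist (γ m) (γ n) ∧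
    dist (γ m) (γ n) ≤ K * |(m : ℝ) - n| + K

/-- A `K`-contracting axis: a `K`-quasigeodesic whose image is `K`-contracting. -/
def IsContractingAxis (K : ℝ) (γ : ℤ → X) : Prop :=
  IsQuasigeodesic K γ ∧ IsContractingSet K (Set.range γ)

/-- Bi-infinite paths `κ`, `η` are independent if `(n, m) ↦ d(κ n, η m)` is proper. -/
def IndependentPaths (κ η : ℤ → X) : Prop :=
  ∀ M : ℝ, 0 < M → Bornology.IsBounded {p : ℤ × ℤ | dist (κ p.1) (η p.2) < M}

end Paths

section Isometries

variable {X : Type*} [MetricSpace X] {G : Type*} [Group G] [MulAction G X]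

/-- The orbit path `n ↦ gⁿ o`. -/
def orbitPath (o : X) (g : G) : ℤ → X := fun n => g ^ n • o

/-- `g` is contracting if its orbit path is a `K`-contracting axis for some `K > 0`. -/
def IsContractingElement (o : X) (g : G) : Prop :=
  ∃ K : ℝ, 0 < K ∧ IsContractingAxis K (orbitPath o g)

/-- `g` and `h` are independent if their orbit paths are. -/
def IndependentElements (o : X) (g h : G) : Prop :=
  IndependentPaths (orbitPath o g) (orbitPath o h)

end Isometries

section RandomWalk

variable {G : Type*} [Group G] [MeasurableSpace G]

/-- The set of atoms of `μ`, i.e. the support of a measure on a countable discrete group. -/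
def atoms (μ : Measure G) : Set G := {g | μ {g} ≠ 0}

/-- `μ` is non-elementary if the semigroup (with identity) generated by its support contains two
independent contracting isometries. -/
def IsNonElementary {X : Type*} [MetricSpace X] [MulAction G X] (o : X) (μ : Measure G) : Prop :=
  ∃ a ∈ Submonoid.closure (atoms μ), ∃ b ∈ Submonoid.closure (atoms μ),
    IsContractingElement o a ∧ IsContractingElement o b ∧ IndependentElements o a b

/-- The first moment `∫ d(o, g o) dμ(g)`, with values in `[0, ∞]`. -/
noncomputable def firstMoment {X : Type*} [MetricSpace X] [MulAction G X] (o : X)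
    (μ : Measure G) : ℝ≥0∞ :=
  ∫⁻ g, edist o (g • o) ∂μ

/-- The law `μ^ℤ` on the step space `G^ℤ`. -/
noncomputable def stepMeasure (μ : Measure G) : Measure (ℤ → G) :=
  Measure.infinitePi fun _ : ℤ => μ

end RandomWalk

/-- The sample path of a step path `(g_n)`: `w_n = g_1 ⋯ g_n` for `n ≥ 0` and
`w_n = g_0⁻¹ g_{-1}⁻¹ ⋯ g_{n+1}⁻¹` for `n < 0`. -/
def samplePath {G : Type*} [Group G] (g : ℤ → G) : ℤ → G
  | Int.ofNat n => ((List.range n).map fun i => g ((i : ℤ) + 1)).prod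
  | Int.negSucc n => ((List.range (n + 1)).map fun i => (g (-(i : ℤ)))⁻¹).prod

end ContractingWalk

/-! Let z be the almost sure value of liminf d(o, w_n o)/n, a constant by the zero-one law.
Everything follows from one estimate (`exists_mul_lintegral_truncDist_le`): there are C ≥ 0 and δ >
0 with δ · E min((d(o, w_k o) - C)⁺, N) ≤ (2k+1) z for all k ≥ 1 and all N. Some w_k moves o by more
than C with positive probability, so z > 0. Taking k = 1 and N → ∞, an infinite first moment forces
z = ∞. If the first moment is finite, the classical strong law on blocks of length m gives limsup ≤
E d(o, w_m o)/m, and a covering argument for subadditive processes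
(`exists_lintegral_le_of_subadditive`) finds m for which the right side is close to z.

The estimate comes from alignment (`exists_aligned`). For every g there are events for a forward and
a backward walk, of probability bounded below uniformly in g, on which the backward walk, the jump g
and the forward walk form an almost geodesic at all times. The displacement of an aligned block,
reduced by C, is then a definite contribution to d(o, w_n o) (`sum_progress_le`). Given its
increment, a block is aligned with probability bounded below, so mean progress is comparable to mean
truncated displacement.

Alignment uses two independent contracting elements as a Schottky pair: every point projects close
to o on at least one of the two axes, so starting the walk with a large power of the right element
points it away from a prescribed point. It must then be unlikely to drift far along the axis. This
is proved without a boundary, using a finitely additive stationary mean ν on G. Sets concentrated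
near infinity have small mean, because some Schottky element gives them many disjoint translates
(`exists_le_of_isFar`). The superharmonic function x ↦ 2ν(x⁻¹U) then bounds the probability of ever
drifting far. -/

namespace ContractingWalk

/-! ### Geodesics and projections to contracting sets -/

section Contracting

variable {X : Type*} [MetricSpace X]

/-- `σ` restricted to `[s, t]` is a unit speed geodesic. -/
def IsGeodesicOn (σ : ℝ → X) (s t : ℝ) : Prop :=
  ∀ u ∈ Set.Icc s t, ∀ v ∈ Set.Icc s t, dist (σ u) (σ v) = |u - v|

theorem IsGeodesicOn.mono {σ : ℝ → X} {s t s' t' : ℝ} (h : IsGeodesicOn σ s t) (hs : s ≤ s')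
    (ht : t' ≤ t) : IsGeodesicOn σ s' t' := fun u hu v hv =>
  h u ⟨hs.trans hu.1, hu.2.trans ht⟩ v ⟨hs.trans hv.1, hv.2.trans ht⟩

theorem IsGeodesicOn.reverse {σ : ℝ → X} {s t : ℝ} (h : IsGeodesicOn σ s t) :
    IsGeodesicOn (fun u => σ (-u)) (-t) (-s) := by
  intro u hu v hv
  rw [h (-u) ⟨by linarith [hu.2], by linarith [hu.1]⟩ (-v) ⟨by linarith [hv.2], by linarith [hv.1]⟩,
    ← abs_neg]
  congr 1
  ring

theorem IsGeodesicOn.dist_eq {σ : ℝ → X} {s t u v : ℝ} (h : IsGeodesicOn σ s t) (hu : s ≤ u)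
    (huv : u ≤ v) (hv : v ≤ t) : dist (σ u) (σ v) = v - u := by
  rw [h u ⟨hu, huv.trans hv⟩ v ⟨hu.trans huv, hv⟩, abs_sub_comm, abs_of_nonneg (by linarith)]

theorem infDist_le_infDist_add {A : Set X} (x y : X) :
    Metric.infDist x A ≤ Metric.infDist y A + dist x y :=
  Metric.infDist_le_infDist_add_dist

/-- The times spent in the closed R-neighbourhood form a compact set, which has a least element. The
clause `u ≠ s` allows for a geodesic that already starts inside. -/
theorem exists_first_entry {A : Set X} {σ : ℝ → X} {s t R : ℝ} (h : IsGeodesicOn σ s t)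
    (hst : s ≤ t) (hR : Metric.infDist (σ t) A ≤ R) :
    ∃ u ∈ Set.Icc s t, Metric.infDist (σ u) A ≤ R ∧
      (u ≠ s → ∀ v ∈ Set.Icc s u, R ≤ Metric.infDist (σ v) A) := by
  set S := {u ∈ Set.Icc s t | Metric.infDist (σ u) A ≤ R} with hS
  have hcont : ContinuousOn (fun u => Metric.infDist (σ u) A) (Set.Icc s t) := by
    have hσ : ContinuousOn σ (Set.Icc s t) := by
      have : LipschitzOnWith 1 σ (Set.Icc s t) := by
        refine LipschitzOnWith.of_dist_le_mul fun u hu v hv => ?_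
        rw [h u hu v hv, Real.dist_eq]
        simp
      exact this.continuousOn
    exact (Metric.continuous_infDist_pt A).comp_continuousOn hσ
  have hcl : IsCompact S := by
    have : IsClosed S := by
      have := hcont.preimage_isClosed_of_isClosed isClosed_Icc (isClosed_Iic (a := R))
      convert this using 1
      rfl
    exact isCompact_Icc.of_isClosed_subset this fun u hu => hu.1
  have hne : S.Nonempty := ⟨t, ⟨hst, le_rfl⟩, hR⟩
  obtain ⟨u, huS, hu⟩ := hcl.exists_isLeast hne
  refine ⟨u, huS.1, huS.2, fun hus v hv => ?_⟩
  have hsu : s < u := lt_of_le_of_ne huS.1.1 (Ne.symm hus)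
  have key : ∀ w ∈ Set.Ico s u, R < Metric.infDist (σ w) A := fun w hw => by
    by_contra hc
    have := hu (show w ∈ S from ⟨⟨hw.1, hw.2.le.trans huS.1.2⟩, not_lt.1 hc⟩)
    linarith [hw.2]
  rcases hv.2.lt_or_eq with hlt | rfl
  · exact (key v ⟨hv.1, hlt⟩).le
  · refine le_of_forall_pos_sub_le fun ε hε => ?_
    set w := max s (v - ε)
    have hw : w ∈ Set.Ico s v := ⟨le_max_left _ _, max_lt hsu (by linarith)⟩
    have h1 := key w hw
    have h2 : dist (σ w) (σ v) = v - w := h.dist_eq hw.1 hw.2.le huS.1.2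
    have h3 := infDist_le_infDist_add (A := A) (σ w) (σ v)
    have h4 : v - ε ≤ w := le_max_right _ _
    linarith

variable {K : ℝ} {A : Set X}

theorem IsContractingSet.dist_le (hA : IsContractingSet K A) {x y p q : X} (hp : p ∈ proj A x)
    (hq : q ∈ proj A y) (h : dist x y ≤ Metric.infDist x A - K) : dist p q ≤ K :=
  hA.2 x y h p (Or.inl hp) q (Or.inr hq)

/-- A piece of length 2K starting at distance at least 3K from A moves the projection by at most K.
So outside the 3K-neighbourhood the projection travels at most at half speed, up to an additive
error. -/
theorem IsContractingSet.dist_le_of_subdivision (hA : IsContractingSet K A) (hK : 0 < K)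
    {σ : ℝ → X} (n : ℕ) :
    ∀ {s t : ℝ} {p q : X}, s ≤ t → IsGeodesicOn σ s t →
      (∀ u ∈ Set.Icc s t, 3 * K ≤ Metric.infDist (σ u) A) → p ∈ proj A (σ s) → q ∈ proj A (σ t) →
      t - s ≤ 2 * K * (n + 1 : ℕ) → dist p q ≤ K * (n + 1 : ℕ) := by
  induction n with
  | zero =>
    intro s t p q hst hσ hfar hp hq hlen
    have := hA.dist_le hp hq (by
      rw [hσ.dist_eq le_rfl hst le_rfl]
      have := hfar s ⟨le_rfl, hst⟩
      norm_num at hlen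
      linarith)
    simpa using this
  | succ n ih =>
    intro s t p q hst hσ hfar hp hq hlen
    set m := min t (s + 2 * K) with hm
    have hsm : s ≤ m := le_min hst (by linarith)
    have hmt : m ≤ t := min_le_left _ _
    obtain ⟨z, hz⟩ := hA.1 (σ m)
    have h1 : dist p z ≤ K := hA.dist_le hp hz (by
      rw [hσ.dist_eq le_rfl hsm hmt]
      have := hfar s ⟨le_rfl, hst⟩
      have : m ≤ s + 2 * K := min_le_right _ _
      linarith)
    have h2 : dist z q ≤ K * (n + 1 : ℕ) := by
      refine ih hmt (hσ.mono hsm le_rfl) (fun u hu => hfar u ⟨hsm.trans hu.1, hu.2⟩) hz hq ?_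
      push_cast at hlen ⊢
      rcases min_choice t (s + 2 * K) with h | h
      · rw [hm, h]
        have : 0 ≤ 2 * K * ((n : ℝ) + 1) := by positivity
        linarith
      · rw [hm, h]; linarith
    have := dist_triangle p z q
    push_cast at h2 ⊢
    linarith

theorem IsContractingSet.dist_le_half_length (hA : IsContractingSet K A) (hK : 0 < K)
    {σ : ℝ → X} {s t : ℝ} {p q : X} (hst : s ≤ t) (hσ : IsGeodesicOn σ s t)
    (hfar : ∀ u ∈ Set.Icc s t, 3 * K ≤ Metric.infDist (σ u) A) (hp : p ∈ proj A (σ s))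
    (hq : q ∈ proj A (σ t)) : dist p q ≤ (t - s) / 2 + K := by
  have h0 : 0 ≤ (t - s) / (2 * K) := div_nonneg (by linarith) (by linarith)
  have h1 := hA.dist_le_of_subdivision hK ⌊(t - s) / (2 * K)⌋₊ hst hσ hfar hp hq (by
    have := (Nat.lt_floor_add_one ((t - s) / (2 * K))).le
    rw [div_le_iff₀ (by positivity)] at this
    push_cast
    linarith)
  have h2 := Nat.floor_le h0
  have h3 : K * ((t - s) / (2 * K)) = (t - s) / 2 := by field_simp
  have h4 := mul_le_mul_of_nonneg_left h2 hK.le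
  push_cast at h1
  linarith

/-- The projection of a geodesic staying far from a contracting set has bounded diameter. -/
theorem IsContractingSet.dist_le_of_far (hA : IsContractingSet K A) (hK : 0 < K)
    {σ : ℝ → X} {s t : ℝ} {p q : X} (hst : s ≤ t) (hσ : IsGeodesicOn σ s t)
    (hfar : ∀ u ∈ Set.Icc s t, 3 * K ≤ Metric.infDist (σ u) A) (hp : p ∈ proj A (σ s))
    (hq : q ∈ proj A (σ t)) : dist p q ≤ 8 * K := by
  have hlen := hσ.dist_eq le_rfl hst le_rfl
  set r₁ := Metric.infDist (σ s) A with hr₁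
  set r₂ := Metric.infDist (σ t) A with hr₂
  have f1 : 3 * K ≤ r₁ := hfar s ⟨le_rfl, hst⟩
  have f2 : 3 * K ≤ r₂ := hfar t ⟨hst, le_rfl⟩
  have htri : t - s ≤ r₁ + dist p q + r₂ := by
    rw [← hlen, hr₁, hr₂, ← hp.2, ← hq.2, dist_comm (σ t) q]
    linarith [dist_triangle (σ s) p (σ t), dist_triangle p q (σ t)]
  by_cases c1 : t - s ≤ r₁ - K
  · linarith [hA.dist_le hp hq (by rw [hlen]; exact c1)]
  by_cases c2 : t - s ≤ r₂ - K
  · linarith [hA.dist_le hq hp (by rw [dist_comm, hlen]; exact c2), dist_comm p q]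
  -- The end segments of lengths `r₁ - K` and `r₂ - K` move the projection by at most K each. By the
  -- triangle inequality the middle has length at most d(p,q) + 2K, and half speed gives d(p,q) ≤
  -- d(p,q)/2 + 4K.
  push Not at c1 c2
  obtain ⟨p', hp'⟩ := hA.1 (σ (s + (r₁ - K)))
  obtain ⟨q', hq'⟩ := hA.1 (σ (t - (r₂ - K)))
  have d1 : dist p p' ≤ K := hA.dist_le hp hp' (by
    rw [hσ.dist_eq le_rfl (by linarith) (by linarith)]; linarith)
  have d2 : dist q q' ≤ K := hA.dist_le hq hq' (by
    rw [dist_comm, hσ.dist_eq (by linarith) (by linarith) le_rfl]; linarith)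
  have d3 := dist_triangle p p' q
  by_cases c3 : s + (r₁ - K) ≤ t - (r₂ - K)
  · have h := hA.dist_le_half_length hK c3 (hσ.mono (by linarith) (by linarith))
      (fun u hu => hfar u ⟨by linarith [hu.1], by linarith [hu.2]⟩) hp' hq'
    have d4 := dist_triangle p' q' q
    rw [dist_comm q' q] at d4
    linarith
  · have d5 : dist q p' ≤ K := hA.dist_le hq hp' (by
      rw [dist_comm, hσ.dist_eq (by linarith) (by linarith) le_rfl]; linarith)
    rw [dist_comm q p'] at d5
    linarith

theorem IsContractingSet.exists_near_of_infDist_le (hA : IsContractingSet K A) (hK : 0 < K)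
    {σ : ℝ → X} {s t : ℝ} {p : X} (hst : s ≤ t) (hσ : IsGeodesicOn σ s t)
    (ht : Metric.infDist (σ t) A ≤ 3 * K) (hp : p ∈ proj A (σ s)) :
    ∃ u ∈ Set.Icc s t, dist (σ u) p ≤ 11 * K := by
  obtain ⟨u, hu, hu3, hfar⟩ := exists_first_entry hσ hst ht
  refine ⟨u, hu, ?_⟩
  by_cases hus : u = s
  · subst hus
    rw [hp.2]
    linarith
  · obtain ⟨q, hq⟩ := hA.1 (σ u)
    have h := hA.dist_le_of_far hK hu.1 (hσ.mono le_rfl hu.2) (hfar hus) hp hq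
    have := dist_triangle (σ u) q p
    rw [hq.2, dist_comm q p] at this
    linarith

/-- A geodesic between two points with distant projections to a contracting set passes close to
both projections, in order. -/
theorem IsContractingSet.exists_near (hA : IsContractingSet K A) (hK : 0 < K)
    {σ : ℝ → X} {s t : ℝ} {p q : X} (hst : s ≤ t) (hσ : IsGeodesicOn σ s t)
    (hp : p ∈ proj A (σ s)) (hq : q ∈ proj A (σ t)) (hpq : 8 * K < dist p q) :
    ∃ u v, s ≤ u ∧ u ≤ v ∧ v ≤ t ∧ dist (σ u) p ≤ 11 * K ∧ dist (σ v) q ≤ 11 * K := by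
  obtain ⟨z, hz, hz3⟩ : ∃ z ∈ Set.Icc s t, Metric.infDist (σ z) A ≤ 3 * K := by
    by_contra hc
    push Not at hc
    linarith [hA.dist_le_of_far hK hst hσ (fun u hu => (hc u hu).le) hp hq]
  obtain ⟨u, hu, hup⟩ := hA.exists_near_of_infDist_le hK hz.1 (hσ.mono le_rfl hz.2) hz3 hp
  obtain ⟨v, hv, hvq⟩ := hA.exists_near_of_infDist_le hK (σ := fun u => σ (-u)) (p := q)
    (neg_le_neg hz.2) (hσ.mono hz.1 le_rfl).reverse (by simpa using hz3) (by simpa using hq)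
  exact ⟨u, -v, hu.1, by linarith [hu.2, hv.2], by linarith [hv.1], hup, hvq⟩

/-- Points with distant projections to a contracting set satisfy a reversed triangle inequality. -/
theorem IsContractingSet.le_dist (hX : IsGeodesicSpace X) (hA : IsContractingSet K A) (hK : 0 < K)
    {x y p q : X} (hp : p ∈ proj A x) (hq : q ∈ proj A y) (hpq : 8 * K < dist p q) :
    dist x p + dist p q + dist q y - 44 * K ≤ dist x y := by
  obtain ⟨σ, h0, h1, hσ⟩ := hX x y
  have hσ : IsGeodesicOn σ 0 (dist x y) := hσ
  obtain ⟨u, v, hu, huv, hv, hup, hvq⟩ := hA.exists_near hK dist_nonneg hσ (by rwa [h0])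
    (by rwa [h1]) hpq
  have e1 := hσ.dist_eq le_rfl hu (huv.trans hv)
  have e2 := hσ.dist_eq hu huv hv
  have e3 := hσ.dist_eq (hu.trans huv) hv le_rfl
  rw [h0] at e1
  rw [h1] at e3
  have t1 := dist_triangle x (σ u) p
  have t2 := dist_triangle4 p (σ u) (σ v) q
  have t3 := dist_triangle q (σ v) y
  rw [dist_comm p (σ u)] at t2
  rw [dist_comm q (σ v)] at t3
  linarith

/-- Geodesics between points of a contracting set stay close to it. -/
theorem IsContractingSet.infDist_geodesic_le (hA : IsContractingSet K A) (hK : 0 < K)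
    {σ : ℝ → X} {s t : ℝ} (hσ : IsGeodesicOn σ s t)
    (hs : σ s ∈ A) (ht : σ t ∈ A) {u : ℝ} (hu : u ∈ Set.Icc s t) :
    Metric.infDist (σ u) A ≤ 17 * K := by
  by_contra hc
  push Not at hc
  obtain ⟨v, hv, hv3, hvfar⟩ := exists_first_entry (A := A) (R := 3 * K)
    (hσ.mono hu.1 le_rfl) hu.2 (by rw [Metric.infDist_zero_of_mem ht]; positivity)
  obtain ⟨w, hw, hw3, hwfar⟩ := exists_first_entry (A := A) (R := 3 * K)
    (hσ.mono le_rfl hu.2).reverse (neg_le_neg hu.1)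
    (by simp only [neg_neg]; rw [Metric.infDist_zero_of_mem hs]; positivity)
  have hvu : v ≠ u := by rintro rfl; linarith
  have hwu : w ≠ -u := by rintro rfl; rw [neg_neg] at hw3; linarith
  obtain ⟨p, hp⟩ := hA.1 (σ (-w))
  obtain ⟨q, hq⟩ := hA.1 (σ v)
  have hw1 : -w ≤ u := by linarith [hw.1]
  have hw2 : s ≤ -w := by linarith [hw.2]
  -- `[-w, v]` is the excursion outside the 3K-neighbourhood around `u`. Its length is at most 3K +
  -- 8K + 3K, and adding the final distance 3K to A gives 17K.
  have h := hA.dist_le_of_far hK (hw1.trans hv.1) (hσ.mono hw2 hv.2) (fun z hz => by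
    rcases le_total z u with hzu | hzu
    · have := hwfar hwu (-z) ⟨by linarith, by linarith [hz.1]⟩
      rwa [neg_neg] at this
    · exact hvfar hvu z ⟨hzu, hz.2⟩) hp hq
  have e1 := hσ.dist_eq hw2 (hw1.trans hv.1) hv.2
  have e2 := hσ.dist_eq hu.1 hv.1 hv.2
  have t1 := dist_triangle4 (σ (-w)) p q (σ v)
  rw [hp.2, dist_comm q, hq.2] at t1
  have t2 := infDist_le_infDist_add (A := A) (σ u) (σ v)
  linarith

end Contracting

/-! ### Contracting quasigeodesics are almost geodesic -/

section Axes

variable {X : Type*} [MetricSpace X] {K : ℝ} {γ : ℤ → X}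

theorem IsQuasigeodesic.abs_sub_le (hγ : IsQuasigeodesic K γ) (hK : 0 < K) (m n : ℤ) :
    |(m : ℝ) - n| ≤ K * (dist (γ m) (γ n) + K) := by
  have h := (hγ m n).1
  have : |(m : ℝ) - n| / K ≤ dist (γ m) (γ n) + K := by linarith
  rwa [div_le_iff₀' hK] at this

theorem IsContractingSet.exists_dist_geodesic_le (hA : IsContractingSet K (Set.range γ))
    (hK : 0 < K) {σ : ℝ → X} {s t : ℝ} (hσ : IsGeodesicOn σ s t) {i k : ℤ} (hs : σ s = γ i)
    (ht : σ t = γ k) {u : ℝ} (hu : u ∈ Set.Icc s t) : ∃ n, dist (σ u) (γ n) ≤ 17 * K := by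
  obtain ⟨_, ⟨n, rfl⟩, hn⟩ := hA.1 (σ u)
  exact ⟨n, hn.trans_le (hA.infDist_geodesic_le hK hσ ⟨i, hs.symm⟩ ⟨k, ht.symm⟩ hu)⟩

/-- Contracting quasigeodesics are Morse: they almost satisfy the triangle equality. -/
theorem IsContractingAxis.exists_dist_add_dist_le (hX : IsGeodesicSpace X) (hK : 0 < K)
    (hγ : IsContractingAxis K γ) : ∃ C : ℝ, ∀ i j k : ℤ, i ≤ j → j ≤ k →
      dist (γ i) (γ j) + dist (γ j) (γ k) ≤ dist (γ i) (γ k) + C := by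
  obtain ⟨hq, hA⟩ := hγ
  set B : ℝ := 17 * K + (K * (K * (35 * K + 1)) + K) with hB
  refine ⟨2 * B, fun i j k hij hjk => ?_⟩
  obtain ⟨σ, h0, h1, hσ⟩ := hX (γ i) (γ k)
  have hσ : IsGeodesicOn σ 0 (dist (γ i) (γ k)) := hσ
  set ℓ := dist (γ i) (γ k) with hℓ
  have hℓ0 : 0 ≤ ℓ := dist_nonneg
  -- A discrete intermediate value argument: walking along σ in unit steps, either the endpoint is
  -- still close to an index ≤ j, or there are consecutive times close to indices on both sides of
  -- j. Those indices are then boundedly close to each other, so γ j is close to σ.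
  let P : ℕ → Prop := fun s => ∃ n : ℤ, n ≤ j ∧ dist (σ (min s ℓ)) (γ n) ≤ 17 * K
  have hmem : ∀ s : ℕ, min (s : ℝ) ℓ ∈ Set.Icc 0 ℓ := fun s =>
    ⟨le_min (Nat.cast_nonneg _) hℓ0, min_le_right _ _⟩
  have hP0 : P 0 := ⟨i, hij, by simp [hℓ0, h0, hK.le]⟩
  by_cases hP : ∀ s, P s → P (s + 1)
  · have hall : ∀ s, P s := fun s => Nat.rec hP0 hP s
    obtain ⟨n, hnj, hn⟩ := hall ⌈ℓ⌉₊
    rw [min_eq_right (Nat.le_ceil ℓ), h1] at hn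
    have h2 := hq.abs_sub_le hK k n
    have h3 : |(j : ℝ) - k| ≤ |(k : ℝ) - n| := by
      have e1 : (n : ℝ) ≤ j := by exact_mod_cast hnj
      have e2 : (j : ℝ) ≤ k := by exact_mod_cast hjk
      rw [abs_sub_comm, abs_of_nonneg (by linarith), abs_of_nonneg (by linarith)]
      linarith
    have h4 := (hq j k).2
    have h5 : K * (dist (γ k) (γ n) + K) ≤ K * (35 * K + 1) :=
      mul_le_mul_of_nonneg_left (by linarith) hK.le
    have h6 : K * |(j : ℝ) - k| ≤ K * (K * (35 * K + 1)) :=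
      mul_le_mul_of_nonneg_left (by linarith) hK.le
    have h7 := dist_triangle (γ i) (γ k) (γ j)
    rw [dist_comm (γ k) (γ j)] at h7
    linarith
  · push Not at hP
    obtain ⟨s, ⟨n, hnj, hn⟩, hs'⟩ := hP
    obtain ⟨n', hn'⟩ := hA.exists_dist_geodesic_le hK hσ h0 h1 (hmem (s + 1))
    have hjn' : j < n' := by
      by_contra hc
      exact hs' ⟨n', not_lt.1 hc, hn'⟩
    have hstep : dist (σ (min (s : ℝ) ℓ)) (σ (min ((s + 1 : ℕ) : ℝ) ℓ)) ≤ 1 := by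
      rw [hσ _ (hmem s) _ (hmem (s + 1)), abs_sub_comm]
      refine (abs_min_sub_min_le_max _ _ _ _).trans ?_
      simp
    have h2 := hq.abs_sub_le hK n' n
    have h3 : |(n : ℝ) - j| ≤ |(n' : ℝ) - n| := by
      have e1 : (n : ℝ) ≤ j := by exact_mod_cast hnj
      have e2 : (j : ℝ) ≤ n' := by exact_mod_cast hjn'.le
      rw [abs_sub_comm, abs_of_nonneg (by linarith), abs_of_nonneg (by linarith)]
      linarith
    have h4 := (hq n j).2
    have h8 := dist_triangle4 (γ n') (σ (min ((s + 1 : ℕ) : ℝ) ℓ)) (σ (min (s : ℝ) ℓ)) (γ n)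
    rw [dist_comm (γ n') (σ _), dist_comm (σ (min ((s + 1 : ℕ) : ℝ) ℓ)) (σ (min (s : ℝ) ℓ))] at h8
    have h5 : K * (dist (γ n') (γ n) + K) ≤ K * (35 * K + 1) :=
      mul_le_mul_of_nonneg_left (by linarith) hK.le
    have h6 : K * |(n : ℝ) - j| ≤ K * (K * (35 * K + 1)) :=
      mul_le_mul_of_nonneg_left (by linarith) hK.le
    have h9 := dist_triangle (σ (min (s : ℝ) ℓ)) (γ n) (γ j)
    have e1 := hσ.dist_eq le_rfl (hmem s).1 (hmem s).2
    have e2 := hσ.dist_eq (hmem s).1 (hmem s).2 le_rfl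
    rw [h0] at e1
    rw [h1] at e2
    have t1 := dist_triangle (γ i) (σ (min (s : ℝ) ℓ)) (γ j)
    have t2 := dist_triangle (γ j) (σ (min (s : ℝ) ℓ)) (γ k)
    rw [dist_comm (γ j) (σ (min (s : ℝ) ℓ))] at t2
    linarith

end Axes

/-! ### Coarse projection to the axis of a contracting element -/

section AxisProjection

variable {X : Type*} [MetricSpace X] {G : Type*} [Group G] [MulAction G X]

/-- `idx x` is the index of a closest point projection of `x` to the axis `n ↦ cⁿ o`; the constant
`Q` controls the contracting geometry of this axis. -/
structure IsAxisProjection (o : X) (c : G) (idx : X → ℤ) (Q : ℝ) : Prop where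
  pos : 0 < Q
  abs_index_sub_le : ∀ n : ℤ, |(idx (c ^ n • o) : ℝ) - n| ≤ Q
  dist_orbit_le : ∀ n : ℤ, dist (c ^ n • o) o ≤ Q * |(n : ℝ)| + Q
  abs_le_dist_orbit : ∀ n : ℤ, |(n : ℝ)| ≤ Q * dist (c ^ n • o) o + Q
  le_dist : ∀ x y, Q ≤ |(idx x : ℝ) - idx y| →
    dist x (c ^ idx x • o) + dist (c ^ idx x • o) (c ^ idx y • o) + dist (c ^ idx y • o) y
      ≤ dist x y + Q
  far : ∀ D' : ℝ, ∃ D : ℝ, ∀ e x y,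
    ((idx e : ℝ) + D ≤ idx x ∧ (idx e : ℝ) + D ≤ idx y) ∨
      ((idx x : ℝ) + D ≤ idx e ∧ (idx y : ℝ) + D ≤ idx e) →
      D' ≤ dist x e + dist y e - dist x y
  equivariant : ∀ (n : ℤ) (x : X), |(idx (c ^ n • x) : ℝ) - idx x - n| ≤ Q
  dist_le : ∀ (x : X) (n : ℤ), dist x (c ^ idx x • o) ≤ dist x (c ^ n • o)
  geodesic_near : ∀ (m n : ℤ) (σ : ℝ → X) (s t : ℝ), IsGeodesicOn σ s t → σ s = c ^ m • o →
    σ t = c ^ n • o → ∀ u ∈ Set.Icc s t, ∃ i : ℤ, dist (σ u) (c ^ i • o) ≤ Q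
  exists_near : ∀ (σ : ℝ → X) (s t : ℝ), s ≤ t → IsGeodesicOn σ s t →
    Q ≤ |(idx (σ s) : ℝ) - idx (σ t)| → ∃ u ∈ Set.Icc s t, dist (σ u) (c ^ idx (σ t) • o) ≤ Q

theorem IsAxisProjection.mono {o : X} {c : G} {idx : X → ℤ} {Q Q' : ℝ}
    (h : IsAxisProjection o c idx Q) (hQ : Q ≤ Q') : IsAxisProjection o c idx Q' where
  pos := h.pos.trans_le hQ
  abs_index_sub_le n := (h.abs_index_sub_le n).trans hQ
  dist_orbit_le n := (h.dist_orbit_le n).trans (by gcongr)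
  abs_le_dist_orbit n := (h.abs_le_dist_orbit n).trans (by gcongr)
  le_dist x y hxy := (h.le_dist x y (hQ.trans hxy)).trans (by gcongr)
  far := h.far
  equivariant n x := (h.equivariant n x).trans hQ
  dist_le := h.dist_le
  geodesic_near m n σ s t h1 h2 h3 u hu :=
    (h.geodesic_near m n σ s t h1 h2 h3 u hu).imp fun _ hi => hi.trans hQ
  exists_near σ s t h1 h2 h3 :=
    (h.exists_near σ s t h1 h2 (hQ.trans h3)).imp fun _ hi => ⟨hi.1, hi.2.trans hQ⟩

theorem proj_smul [IsIsometricSMul G X] {o : X} {c : G} {x : X} {n i : ℤ}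
    (h : c ^ i • o ∈ proj (Set.range (orbitPath o c)) x) :
    c ^ (n + i) • o ∈ proj (Set.range (orbitPath o c)) (c ^ n • x) := by
  refine ⟨⟨n + i, rfl⟩, ?_⟩
  have himg : (fun z => c ^ n • z) '' Set.range (orbitPath o c) = Set.range (orbitPath o c) := by
    ext z
    constructor
    · rintro ⟨_, ⟨j, rfl⟩, rfl⟩
      exact ⟨n + j, by simp [orbitPath, zpow_add, mul_smul]⟩
    · rintro ⟨j, rfl⟩
      exact ⟨c ^ (j - n) • o, ⟨j - n, rfl⟩, by
        simp only [orbitPath]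
        rw [smul_smul, ← zpow_add]
        congr 2
        ring⟩
  rw [zpow_add, mul_smul, dist_smul, h.2]
  conv_rhs => rw [← himg]
  rw [Metric.infDist_image (isometry_smul X (c ^ n))]

theorem IsContractingElement.exists_isAxisProjection [IsIsometricSMul G X]
    (hX : IsGeodesicSpace X) {o : X} {c : G} (hc : IsContractingElement o c) :
    ∃ (idx : X → ℤ) (Q : ℝ), IsAxisProjection o c idx Q := by
  obtain ⟨K, hK, hq, hA⟩ := hc
  obtain ⟨C, hC⟩ := IsContractingAxis.exists_dist_add_dist_le hX hK ⟨hq, hA⟩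
  have hex : ∀ x, ∃ i : ℤ, c ^ i • o ∈ proj (Set.range (orbitPath o c)) x := fun x => by
    obtain ⟨_, ⟨i, rfl⟩, hi⟩ := hA.1 x
    exact ⟨i, ⟨i, rfl⟩, hi⟩
  choose idx hidx using hex
  have hzero : ∀ n : ℤ, c ^ n • o ∈ proj (Set.range (orbitPath o c)) (c ^ n • o) := fun n =>
    ⟨⟨n, rfl⟩, by
      rw [dist_self, Metric.infDist_zero_of_mem (show c ^ n • o ∈ Set.range (orbitPath o c) from ⟨n, rfl⟩)]⟩
  -- Far from the axis this is the contracting condition with y = x; within K of it both points lie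
  -- within K of x.
  have hdiam : ∀ {x p q}, p ∈ proj (Set.range (orbitPath o c)) x →
      q ∈ proj (Set.range (orbitPath o c)) x → dist p q ≤ 2 * K := fun {x p q} hp hq => by
    by_cases h : K ≤ Metric.infDist x (Set.range (orbitPath o c))
    · have := hA.dist_le hp hq (by rw [dist_self]; linarith)
      linarith
    · have := dist_triangle_left p q x
      rw [hp.2, hq.2] at this
      linarith
  have hclose : ∀ {m n : ℤ} {x}, c ^ m • o ∈ proj (Set.range (orbitPath o c)) x →
      c ^ n • o ∈ proj (Set.range (orbitPath o c)) x → |(m : ℝ) - n| ≤ K * (3 * K) :=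
    fun {m n x} hm hn => (hq.abs_sub_le hK m n).trans
      (by gcongr; linarith [show dist (orbitPath o c m) (orbitPath o c n) ≤ 2 * K from hdiam hm hn])
  have hbig : ∀ {m n : ℤ}, K * (10 * K) ≤ |(m : ℝ) - n| → 8 * K < dist (c ^ m • o) (c ^ n • o) :=
    fun {m n} h => by
      have := le_of_mul_le_mul_left (h.trans (hq.abs_sub_le hK m n)) hK
      change 10 * K ≤ dist (c ^ m • o) (c ^ n • o) + K at this
      linarith
  set Q : ℝ := K * (10 * K) + 44 * K with hQ
  have hKK : 0 < K * (10 * K) := by positivity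
  have hQ0 : 0 < Q := by positivity
  refine ⟨idx, Q, ?_⟩
  have hle : ∀ x y, K * (10 * K) ≤ |(idx x : ℝ) - idx y| →
      dist x (c ^ idx x • o) + dist (c ^ idx x • o) (c ^ idx y • o) + dist (c ^ idx y • o) y
        ≤ dist x y + 44 * K := fun x y h => by
    have := hA.le_dist hX hK (hidx x) (hidx y) (hbig h)
    linarith
  constructor
  · exact hQ0
  · exact fun n => (hclose (hidx _) (hzero n)).trans (by nlinarith)
  · intro n
    have h := (hq n 0).2
    simp only [orbitPath, zpow_zero, one_smul, Int.cast_zero, sub_zero] at h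
    refine h.trans ?_
    gcongr <;> nlinarith
  · intro n
    have h := hq.abs_sub_le hK n 0
    simp only [orbitPath, zpow_zero, one_smul, Int.cast_zero, sub_zero] at h
    refine h.trans ?_
    rw [mul_add]
    gcongr <;> nlinarith
  · intro x y h
    have := hle x y (by linarith)
    linarith
  · intro D'
    -- The term 10K makes `hle` applicable, C is the Morse defect, and 88K pays for the two reversed
    -- triangle inequalities from e.
    refine ⟨K * (10 * K + |D'| + |C| + 88 * K), fun e x y h => ?_⟩
    have hb : 0 ≤ |D'| + |C| + 88 * K := by positivity
    have hbK : 0 ≤ K * (|D'| + |C| + 88 * K) := mul_nonneg hK.le hb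
    have hd : ∀ {m n : ℤ}, K * (10 * K + |D'| + |C| + 88 * K) ≤ |(m : ℝ) - n| →
        9 * K + |D'| + |C| + 88 * K ≤ dist (c ^ m • o) (c ^ n • o) := fun {m n} h => by
      have := le_of_mul_le_mul_left (h.trans (hq.abs_sub_le hK m n)) hK
      change _ ≤ dist (c ^ m • o) (c ^ n • o) + K at this
      linarith
    have hx : K * (10 * K + |D'| + |C| + 88 * K) ≤ |(idx x : ℝ) - idx e| := by
      rcases h with h | h
      · exact le_trans (by linarith) (le_abs_self _)
      · exact le_trans (by linarith) (neg_le_abs _)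
    have hy : K * (10 * K + |D'| + |C| + 88 * K) ≤ |(idx y : ℝ) - idx e| := by
      rcases h with h | h
      · exact le_trans (by linarith) (le_abs_self _)
      · exact le_trans (by linarith) (neg_le_abs _)
    have h1 := hle x e (by linarith)
    have h2 := hle y e (by linarith)
    have h3 := hd hx
    have h4 := hd hy
    have h5 := dist_triangle4 x (c ^ idx x • o) (c ^ idx y • o) y
    -- Both projections lie on the same side of that of e, so along the axis their distance is
    -- nearly the difference of their distances to it.
    have h6 : dist (c ^ idx x • o) (c ^ idx y • o) ≤
        dist (c ^ idx x • o) (c ^ idx e • o) + dist (c ^ idx y • o) (c ^ idx e • o) + C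
          - 2 * min (dist (c ^ idx x • o) (c ^ idx e • o))
            (dist (c ^ idx y • o) (c ^ idx e • o)) := by
      have key : ∀ i j : ℤ, (idx e ≤ i ∧ i ≤ j) ∨ (j ≤ i ∧ i ≤ idx e) →
          dist (c ^ idx e • o) (c ^ i • o) + dist (c ^ i • o) (c ^ j • o) ≤
            dist (c ^ idx e • o) (c ^ j • o) + C := by
        rintro i j (h | h)
        · exact hC _ _ _ h.1 h.2
        · have := hC _ _ _ h.1 h.2
          simp only [orbitPath] at this
          rw [dist_comm (c ^ idx e • o) (c ^ i • o), dist_comm (c ^ i • o) (c ^ j • o),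
            dist_comm (c ^ idx e • o) (c ^ j • o)]
          linarith
      have hi : (idx e ≤ idx x ∧ idx e ≤ idx y) ∨ (idx x ≤ idx e ∧ idx y ≤ idx e) := by
        rcases h with h | h
        · left
          constructor <;> (have : 0 ≤ K * (10 * K) := hKK.le; rify; linarith)
        · right
          constructor <;> (have : 0 ≤ K * (10 * K) := hKK.le; rify; linarith)
      have hord : ((idx e ≤ idx x ∧ idx x ≤ idx y) ∨ (idx y ≤ idx x ∧ idx x ≤ idx e)) ∨
          ((idx e ≤ idx y ∧ idx y ≤ idx x) ∨ (idx x ≤ idx y ∧ idx y ≤ idx e)) := by omega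
      rw [dist_comm _ (c ^ idx e • o), dist_comm _ (c ^ idx e • o)]
      rcases hord with h | h
      · have := key _ _ h
        have := min_le_left (dist (c ^ idx e • o) (c ^ idx x • o))
          (dist (c ^ idx e • o) (c ^ idx y • o))
        linarith
      · have := key _ _ h
        rw [dist_comm (c ^ idx y • o) (c ^ idx x • o)] at this
        have := min_le_right (dist (c ^ idx e • o) (c ^ idx x • o))
          (dist (c ^ idx e • o) (c ^ idx y • o))
        linarith
    have h7 := le_min h3 h4
    have h8 : 0 ≤ dist (c ^ idx e • o) e := dist_nonneg
    have h9 := le_abs_self C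
    have h10 := le_abs_self D'
    have h11 := abs_nonneg C
    have h12 := abs_nonneg D'
    rw [dist_comm (c ^ idx y • o) y] at h5
    linarith
  · intro n x
    have := hclose (hidx (c ^ n • x)) (proj_smul (n := n) (hidx x))
    push_cast at this
    rw [show (idx (c ^ n • x) : ℝ) - (n + idx x) = idx (c ^ n • x) - idx x - n by ring] at this
    nlinarith
  · intro x n
    rw [(hidx x).2]
    exact Metric.infDist_le_dist_of_mem ⟨n, rfl⟩
  · intro m n σ s t hσ hs ht u hu
    obtain ⟨i, hi⟩ := hA.exists_dist_geodesic_le hK hσ (i := m) (k := n) hs ht hu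
    exact ⟨i, hi.trans (by linarith)⟩
  · intro σ s t hst hσ h
    obtain ⟨u, v, hu, huv, hv, -, hvq⟩ := hA.exists_near hK hst hσ (hidx _) (hidx _)
      (hbig (by linarith))
    exact ⟨v, ⟨hu.trans huv, hv⟩, hvq.trans (by linarith)⟩

end AxisProjection

/-! ### Schottky pairs from two independent contracting elements -/

section Pairs

variable {X : Type*} [MetricSpace X] {G : Type*} [Group G] [MulAction G X]

/-- `A` is contained in a small neighborhood of infinity as seen from `o`: the (doubled) Gromov
products based at `o` of the points of `A • o` are at least `D`. -/
def IsFar (o : X) (D : ℝ) (A : Set G) : Prop :=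
  ∀ x ∈ A, ∀ y ∈ A, D ≤ dist (x • o) o + dist (y • o) o - dist (x • o) (y • o)

theorem IsFar.mono {o : X} {D D' : ℝ} {A : Set G} (h : IsFar o D A) (hD : D' ≤ D) :
    IsFar o D' A := fun x hx y hy => hD.trans (h x hx y hy)

theorem IsFar.preimage_mul_left [IsIsometricSMul G X] {o : X} {D : ℝ} {A : Set G}
    (h : IsFar o D A) (g : G) : IsFar o (D - 2 * dist (g • o) o) ((g * ·) ⁻¹' A) := by
  intro x hx y hy
  have h1 := h _ hx _ hy
  simp only [mul_smul, dist_smul] at h1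
  have h2 := dist_triangle (g • x • o) (g • o) o
  have h3 := dist_triangle (g • y • o) (g • o) o
  rw [dist_smul] at h2 h3
  linarith

theorem dist_le_of_abs_index_le {o : X} {c : G} {idx : X → ℤ} {Q R : ℝ}
    (h : IsAxisProjection o c idx Q) {n : ℤ} (hn : |(n : ℝ)| ≤ R) :
    dist (c ^ n • o) o ≤ Q * R + Q :=
  (h.dist_orbit_le n).trans (by have := h.pos; gcongr)

/-- If bᵐo projects away from o on the a-axis, the geodesic from o to bᵐo passes near that
projection while staying near the b-axis. Independence bounds the index of such a near encounter of
the axes. -/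
theorem exists_abs_index_orbit_le (hX : IsGeodesicSpace X) {o : X} {a b : G} {ia ib : X → ℤ}
    {Q : ℝ} (ha : IsAxisProjection o a ia Q) (hb : IsAxisProjection o b ib Q)
    (hab : IndependentElements o a b) : ∃ R : ℝ, ∀ m : ℤ, |(ia (b ^ m • o) : ℝ)| ≤ R := by
  have hQ := ha.pos
  obtain ⟨R, hR⟩ := (hab (2 * Q + 1) (by positivity)).subset_closedBall (0 : ℤ × ℤ)
  refine ⟨max R (2 * Q), fun m => ?_⟩
  by_cases h : Q ≤ |(ia o : ℝ) - ia (b ^ m • o)|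
  · obtain ⟨σ, h0, h1, hσ⟩ := hX o (b ^ m • o)
    obtain ⟨u, hu, hun⟩ := ha.exists_near σ 0 _ dist_nonneg hσ (by rwa [h0, h1])
    obtain ⟨m', hm'⟩ := hb.geodesic_near 0 m σ 0 _ hσ (by simpa using h0) h1 u hu
    have hd : dist (a ^ ia (σ (dist o (b ^ m • o))) • o) (b ^ m' • o) < 2 * Q + 1 := by
      have := dist_triangle_left (a ^ ia (σ (dist o (b ^ m • o))) • o) (b ^ m' • o) (σ u)
      linarith
    have hmem := hR (show (ia (σ (dist o (b ^ m • o))), m') ∈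
      {p : ℤ × ℤ | dist (orbitPath o a p.1) (orbitPath o b p.2) < 2 * Q + 1} from hd)
    rw [h1, Metric.mem_closedBall, Prod.dist_eq] at hmem
    have h2 := (le_max_left _ _).trans hmem
    rw [Int.dist_eq] at h2
    simp only [Prod.fst_zero, Int.cast_zero, sub_zero] at h2
    exact h2.trans (le_max_left _ _)
  · have h1 := ha.abs_index_sub_le 0
    simp only [zpow_zero, one_smul, Int.cast_zero, sub_zero] at h1
    push Not at h
    refine le_trans ?_ (le_max_right _ _)
    have h2 := abs_sub_abs_le_abs_sub (ia (b ^ m • o) : ℝ) (ia o)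
    rw [abs_sub_comm] at h2
    linarith

/-- With m = `ib x`, the point bᵐo projects near o on the a-axis and x does not, so a geodesic from
x to bᵐo passes near o. Since bᵐo is at least as close to x as o is, it must be close to o. -/
theorem exists_abs_index_le_of_le (hX : IsGeodesicSpace X) {o : X} {a b : G} {ia ib : X → ℤ}
    {Q : ℝ} (ha : IsAxisProjection o a ia Q) (hb : IsAxisProjection o b ib Q)
    (hab : IndependentElements o a b) :
    ∃ R : ℝ, 0 ≤ R ∧ ∀ x, R ≤ |(ia x : ℝ)| → |(ib x : ℝ)| ≤ R := by
  have hQ := ha.pos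
  obtain ⟨R₀, hR₀⟩ := exists_abs_index_orbit_le hX ha hb hab
  have hR₀0 : 0 ≤ R₀ := (abs_nonneg _).trans (hR₀ 0)
  set S : ℝ := Q * (Q + 2 * (Q * R₀ + Q)) + Q with hS
  have hS0 : 0 ≤ S := by positivity
  refine ⟨R₀ + Q + S, by positivity, fun x hx => ?_⟩
  set m := ib x with hm
  have h1 := ha.le_dist x (b ^ m • o) (by
    have := abs_sub_abs_le_abs_sub (ia x : ℝ) (ia (b ^ m • o))
    linarith [hR₀ m])
  have h2 := dist_le_of_abs_index_le ha (hR₀ m)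
  have h3 := hb.dist_le x 0
  rw [zpow_zero, one_smul] at h3
  set q := a ^ ia (b ^ m • o) • o
  have h4 := dist_triangle4 x (a ^ ia x • o) q o
  have h5 := dist_triangle_right (b ^ m • o) o q
  rw [dist_comm (b ^ m • o) q, dist_comm o q] at h5
  have h6 : dist (b ^ m • o) o ≤ Q + 2 * (Q * R₀ + Q) := by linarith
  have h7 := hb.abs_le_dist_orbit m
  have h8 : Q * dist (b ^ m • o) o ≤ Q * (Q + 2 * (Q * R₀ + Q)) := by gcongr
  linarith

/-- Two contracting axes with uniformly controlled, transverse projections. -/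
structure IsSchottkyPair (o : X) (c : Bool → G) (idx : Bool → X → ℤ) (Q : ℝ) : Prop where
  axis : ∀ j, IsAxisProjection o (c j) (idx j) Q
  exists_lt : ∀ x, ∃ j, |(idx j x : ℝ)| < Q
  exists_disjoint : ∃ (k : ℕ) (D : ℝ), ∀ A : Set G, IsFar o D A → ∃ j, ∀ m n : ℤ, m ≠ n →
    Disjoint ((c j ^ (k * m) * ·) ⁻¹' A) ((c j ^ (k * n) * ·) ⁻¹' A)

theorem exists_isSchottkyPair [IsIsometricSMul G X] (hX : IsGeodesicSpace X) {o : X} {a b : G}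
    (ha : IsContractingElement o a) (hb : IsContractingElement o b)
    (hab : IndependentElements o a b) :
    ∃ (idx : Bool → X → ℤ) (Q : ℝ), IsSchottkyPair o (fun j => cond j a b) idx Q := by
  obtain ⟨ia, Qa, ha⟩ := ha.exists_isAxisProjection hX
  obtain ⟨ib, Qb, hb⟩ := hb.exists_isAxisProjection hX
  replace ha := ha.mono (le_max_left Qa Qb)
  replace hb := hb.mono (le_max_right Qa Qb)
  set Q := max Qa Qb
  have hQ := ha.pos
  obtain ⟨R, hR0, hR⟩ := exists_abs_index_le_of_le hX ha hb hab
  set Q' : ℝ := 2 * Q + R + 1 + 2 * (Q * R + Q) with hQ'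
  have hQR : 0 ≤ Q * R := by positivity
  -- Here x projects within R of index 0 on the b-axis while y does not, so geodesics between them
  -- pass near o.
  have hcross : ∀ x y, Q' ≤ |(ia x : ℝ)| → Q' ≤ |(ib y : ℝ)| →
      dist x o + dist y o ≤ dist x y + Q' := fun x y hx hy => by
    have h1 := hR x (by linarith)
    have h2 := hb.le_dist x y (by
      have := abs_sub_abs_le_abs_sub (ib y : ℝ) (ib x)
      rw [abs_sub_comm] at this
      linarith)
    have h3 := dist_le_of_abs_index_le hb h1
    have h4 := dist_triangle x (b ^ ib x • o) o
    have h5 := dist_triangle4 y (b ^ ib y • o) (b ^ ib x • o) o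
    rw [dist_comm y (b ^ ib y • o), dist_comm (b ^ ib y • o) (b ^ ib x • o)] at h5
    linarith
  have hax : ∀ j, IsAxisProjection o (cond j a b) (cond j ia ib) Q' := by
    rintro (_ | _)
    · exact hb.mono (by linarith)
    · exact ha.mono (by linarith)
  -- Gromov products at least `Q' + 1` contradict `hcross`, so A projects into a window of radius Q'
  -- on one axis. Translating by a power shifts the index up to an error Q', so steps of size 4Q'
  -- separate the preimages.
  refine ⟨fun j => cond j ia ib, Q', hax, fun x => ?_, ⌈4 * Q'⌉₊, Q' + 1, fun A hA => ?_⟩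
  · by_cases h : Q' ≤ |(ia x : ℝ)|
    · exact ⟨false, by simpa using (hR x (by linarith)).trans_lt (by linarith)⟩
    · exact ⟨true, by simpa using h⟩
  · obtain ⟨j, hj⟩ : ∃ j, ∀ x ∈ A, |((cond j ia ib) (x • o) : ℝ)| < Q' := by
      by_contra hc
      push Not at hc
      obtain ⟨x, hx, hx'⟩ := hc true
      obtain ⟨y, hy, hy'⟩ := hc false
      have := hA x hx y hy
      have := hcross _ _ hx' hy'
      linarith
    refine ⟨j, fun m n hmn => Set.disjoint_left.2 fun z hm hn => hmn ?_⟩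
    have key : ∀ l : ℤ, cond j a b ^ l * z ∈ A →
        |(cond j ia ib (z • o) : ℝ) + l| < 2 * Q' := fun l hl => by
      have h1 := hj _ hl
      have h2 := (hax j).equivariant l (z • o)
      rw [smul_smul] at h2
      rw [abs_lt] at h1 ⊢
      rw [abs_le] at h2
      constructor <;> linarith
    have h1 := key _ hm
    have h2 := key _ hn
    have h3 : |(⌈4 * Q'⌉₊ : ℝ) * ((m : ℝ) - n)| < 4 * Q' := by
      push_cast at h1 h2
      rw [abs_lt] at h1 h2 ⊢
      constructor <;> linarith
    rw [abs_mul] at h3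
    by_contra hne
    have h4 : (1 : ℝ) ≤ |(m : ℝ) - n| := by
      have : 1 ≤ |m - n| := Int.one_le_abs (sub_ne_zero.2 hne)
      exact_mod_cast this
    have h5 : 4 * Q' ≤ |(⌈4 * Q'⌉₊ : ℝ)| := (Nat.le_ceil _).trans (le_abs_self _)
    have h6 : |(⌈4 * Q'⌉₊ : ℝ)| * 1 ≤ |(⌈4 * Q'⌉₊ : ℝ)| * |(m : ℝ) - n| := by gcongr
    linarith

end Pairs

/-! ### Finitely additive stationary means -/

section StationaryMean

variable {G : Type*} [Group G] [MeasurableSpace G]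

/-- A finitely additive, `μ`-stationary probability on the subsets of `G`. -/
structure IsStationaryMean (μ : Measure G) (ν : Set G → ℝ) : Prop where
  nonneg : ∀ A, 0 ≤ ν A
  univ : ν Set.univ = 1
  union : ∀ A B, Disjoint A B → ν (A ∪ B) = ν A + ν B
  sum_le : ∀ (A : Set G) (S : Finset G), ∑ g ∈ S, μ.real {g} * ν ((g * ·) ⁻¹' A) ≤ ν A

namespace IsStationaryMean

variable {μ : Measure G} {ν : Set G → ℝ}

theorem empty (h : IsStationaryMean μ ν) : ν ∅ = 0 := by
  have := h.union ∅ ∅ (by simp)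
  simp only [Set.union_self] at this
  linarith

theorem mono (h : IsStationaryMean μ ν) {A B : Set G} (hAB : A ⊆ B) : ν A ≤ ν B := by
  have := h.union A (B \ A) Set.disjoint_sdiff_right
  rw [Set.union_sdiff_cancel hAB] at this
  linarith [h.nonneg (B \ A)]

theorem union_le (h : IsStationaryMean μ ν) (A B : Set G) : ν (A ∪ B) ≤ ν A + ν B := by
  rw [← Set.union_sdiff_self, h.union _ _ Set.disjoint_sdiff_right]
  linarith [h.mono (Set.sdiff_subset : B \ A ⊆ B)]

theorem compl (h : IsStationaryMean μ ν) (A : Set G) : ν Aᶜ = 1 - ν A := by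
  have := h.union A Aᶜ disjoint_compl_right
  rw [Set.union_compl_self, h.univ] at this
  linarith

theorem le_one (h : IsStationaryMean μ ν) (A : Set G) : ν A ≤ 1 :=
  h.univ ▸ h.mono (Set.subset_univ A)

theorem sum_range_le_one (h : IsStationaryMean μ ν) {A : ℕ → Set G}
    (hA : Pairwise (Function.onFun Disjoint A)) (N : ℕ) : ∑ n ∈ Finset.range N, ν (A n) ≤ 1 := by
  have key : ∑ n ∈ Finset.range N, ν (A n) = ν (⋃ n ∈ Finset.range N, A n) := by
    induction N with
    | zero => simp [h.empty]
    | succ N ih =>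
      rw [Finset.sum_range_succ, ih, Finset.range_add_one, Finset.set_biUnion_insert, Set.union_comm,
        h.union]
      refine Set.disjoint_iUnion₂_left.2 fun n hn => hA ?_
      exact (Finset.mem_range.1 hn).ne
  rw [key]
  exact h.le_one _

/-- The opposite of `sum_le`, obtained by applying it to the complement; the error is the mass of μ
outside S. -/
theorem le_sum_add (h : IsStationaryMean μ ν) (A : Set G) (S : Finset G) :
    ν A ≤ ∑ g ∈ S, μ.real {g} * ν ((g * ·) ⁻¹' A) + (1 - ∑ g ∈ S, μ.real {g}) := by
  have h1 := h.sum_le Aᶜ S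
  simp only [Set.preimage_compl, h.compl, mul_sub, mul_one, Finset.sum_sub_distrib] at h1
  linarith

end IsStationaryMean

variable [DiscreteMeasurableSpace G]

/-- The law of the `n`-th step of the random walk driven by `μ`. -/
noncomputable def walkLaw (μ : Measure G) : ℕ → Measure G
  | 0 => Measure.dirac 1
  | n + 1 => μ.bind fun g => (walkLaw μ n).map (g * ·)

theorem walkLaw_succ_apply (μ : Measure G) (n : ℕ) (A : Set G) :
    walkLaw μ (n + 1) A = ∫⁻ g, walkLaw μ n ((g * ·) ⁻¹' A) ∂μ := by
  rw [walkLaw, Measure.bind_apply (MeasurableSet.of_discrete) (Measurable.of_discrete.aemeasurable)]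
  refine lintegral_congr fun g => ?_
  rw [Measure.map_apply Measurable.of_discrete MeasurableSet.of_discrete]

instance (μ : Measure G) [IsProbabilityMeasure μ] (n : ℕ) : IsProbabilityMeasure (walkLaw μ n) := by
  induction n with
  | zero => rw [walkLaw]; infer_instance
  | succ n ih => exact ⟨by rw [walkLaw_succ_apply]; simp⟩

variable [Countable G]

theorem sum_walkLaw_le (μ : Measure G) [IsProbabilityMeasure μ] (n : ℕ) (A : Set G)
    (S : Finset G) : ∑ g ∈ S, μ.real {g} * (walkLaw μ n).real ((g * ·) ⁻¹' A) ≤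
      (walkLaw μ (n + 1)).real A := by
  have h : ∑ g ∈ S, walkLaw μ n ((g * ·) ⁻¹' A) * μ {g} ≤ walkLaw μ (n + 1) A := by
    rw [walkLaw_succ_apply, lintegral_countable']
    exact ENNReal.sum_le_tsum S
  have h2 := ENNReal.toReal_mono (measure_ne_top _ _) h
  rw [ENNReal.toReal_sum fun g _ => ENNReal.mul_ne_top (measure_ne_top _ _) (measure_ne_top _ _)]
    at h2
  simpa [measureReal_def, mul_comm] using h2

/-- The mean is the limit, along a nonprincipal ultrafilter, of the Cesàro averages of the laws of
the walk. Such a limit keeps finite additivity only, hence the form of stationarity as an inequality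
over finite sums. -/
theorem exists_isStationaryMean (μ : Measure G) [IsProbabilityMeasure μ] :
    ∃ ν, IsStationaryMean μ ν := by
  let m : ℕ → Set G → ℝ := fun n A => (∑ i ∈ Finset.range (n + 1), (walkLaw μ i).real A) / (n + 1)
  have hm0 : ∀ n A, 0 ≤ m n A := fun n A =>
    div_nonneg (Finset.sum_nonneg fun i _ => measureReal_nonneg) (by positivity)
  have hm1 : ∀ n A, m n A ≤ 1 := fun n A => by
    rw [div_le_one (by positivity)]
    calc _ ≤ ∑ i ∈ Finset.range (n + 1), (1 : ℝ) :=
          Finset.sum_le_sum fun i _ => measureReal_le_one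
      _ = _ := by simp
  have hlim : ∀ A, ∃ x, Tendsto (fun n => m n A) (hyperfilter ℕ : Filter ℕ) (𝓝 x) := fun A => by
    obtain ⟨x, -, hx⟩ := isCompact_iff_ultrafilter_le_nhds.1 (isCompact_Icc (a := (0 : ℝ)) (b := 1))
      ((hyperfilter ℕ).map fun n => m n A) (by
        rw [le_principal_iff]
        exact Filter.mem_map.2 (Filter.univ_mem' fun n => ⟨hm0 n A, hm1 n A⟩))
    exact ⟨x, hx⟩
  choose ν hν using hlim
  refine ⟨ν, fun A => ge_of_tendsto' (hν A) fun n => hm0 n A, ?_, fun A B hAB => ?_, fun A S => ?_⟩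
  · refine tendsto_nhds_unique (hν _) (tendsto_const_nhds.congr fun n => ?_)
    simp only [m, probReal_univ, Finset.sum_const, Finset.card_range, nsmul_eq_mul, mul_one]
    push_cast
    rw [div_self (by positivity)]
  · refine tendsto_nhds_unique (hν _) (((hν A).add (hν B)).congr fun n => ?_)
    have h : ∀ i, (walkLaw μ i).real (A ∪ B) = (walkLaw μ i).real A + (walkLaw μ i).real B :=
      fun i => measureReal_union hAB MeasurableSet.of_discrete
    simp only [m, h, Finset.sum_add_distrib, add_div]
  · have h1 : Tendsto (fun n => ∑ g ∈ S, μ.real {g} * m n ((g * ·) ⁻¹' A))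
        (hyperfilter ℕ : Filter ℕ) (𝓝 (∑ g ∈ S, μ.real {g} * ν ((g * ·) ⁻¹' A))) :=
      tendsto_finsetSum _ fun g _ => (hν _).const_mul _
    have h2 : Tendsto (fun n : ℕ => m n A + 1 / ((n : ℝ) + 1)) (hyperfilter ℕ : Filter ℕ)
        (𝓝 (ν A + 0)) :=
      (hν A).add (tendsto_one_div_add_atTop_nhds_zero_nat.mono_left Nat.hyperfilter_le_atTop)
    rw [add_zero] at h2
    refine le_of_tendsto_of_tendsto' h1 h2 fun n => ?_
    calc ∑ g ∈ S, μ.real {g} * m n ((g * ·) ⁻¹' A)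
        = (∑ i ∈ Finset.range (n + 1),
            ∑ g ∈ S, μ.real {g} * (walkLaw μ i).real ((g * ·) ⁻¹' A)) / (n + 1) := by
          rw [Finset.sum_comm, Finset.sum_div]
          refine Finset.sum_congr rfl fun g _ => ?_
          rw [← Finset.mul_sum, mul_div_assoc]
      _ ≤ (∑ i ∈ Finset.range (n + 1), (walkLaw μ (i + 1)).real A) / (n + 1) := by
          gcongr with i
          exact sum_walkLaw_le μ i A S
      -- Shifting the time index changes the sum by its two end terms only, which costs 1/(n+1) in
      -- the average.
      _ ≤ (∑ i ∈ Finset.range (n + 1), (walkLaw μ i).real A + 1) / (n + 1) := by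
          gcongr
          have := Finset.sum_range_succ' (fun i => (walkLaw μ i).real A) (n + 1)
          rw [Finset.sum_range_succ] at this
          have h3 : (walkLaw μ (n + 1)).real A ≤ 1 := measureReal_le_one
          have h4 : 0 ≤ (walkLaw μ 0).real A := measureReal_nonneg
          linarith [Finset.sum_range_succ' (fun i => (walkLaw μ i).real A) n,
            Finset.sum_range_succ (fun i => (walkLaw μ i).real A) n,
            Finset.sum_range_succ (fun i => (walkLaw μ (i + 1)).real A) n]
      _ = m n A + 1 / ((n : ℝ) + 1) := add_div _ _ _

omit [Group G] in
theorem exists_finset_one_sub_le (μ : Measure G) [IsProbabilityMeasure μ] {η : ℝ} (hη : 0 < η) :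
    ∃ S : Finset G, 1 - η ≤ ∑ g ∈ S, μ.real {g} := by
  have h : HasSum (fun g => μ.real {g}) 1 := by
    have h1 : ∑' g, μ {g} = 1 := by
      have := lintegral_countable' (μ := μ) (fun _ => (1 : ℝ≥0∞))
      simpa using this.symm
    have hne : ∑' g, μ {g} ≠ ∞ := by simp [h1]
    have h2 := ENNReal.hasSum_toReal hne
    rwa [← ENNReal.tsum_toReal_eq fun g => measure_ne_top _ _, h1, ENNReal.toReal_one] at h2
  obtain ⟨S, hS⟩ := (h.eventually (lt_mem_nhds (show 1 - η < 1 by linarith))).exists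
  exact ⟨S, hS.le⟩

end StationaryMean

/-! ### Far sets have small mean -/

section FarSets

variable {X : Type*} [MetricSpace X] {G : Type*} [Group G] [MulAction G X] [IsIsometricSMul G X]
  [MeasurableSpace G] [Countable G] [DiscreteMeasurableSpace G]
  {μ : Measure G} [IsProbabilityMeasure μ] {ν : Set G → ℝ} {o : X}

/-- Translating a far set of almost maximal mean by an element of the semigroup generated by the
atoms of `μ` keeps the mean almost maximal. -/
theorem IsStationaryMean.le_preimage_of_mem_closure (hν : IsStationaryMean μ ν) {F : ℝ}
    (hF : ∀ η > 0, ∃ D, ∀ A : Set G, IsFar o D A → ν A ≤ F + η) {g : G}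
    (hg : g ∈ Submonoid.closure (atoms μ)) :
    ∀ ε > 0, ∃ δ > 0, ∃ D, ∀ A : Set G, IsFar o D A → F - δ ≤ ν A → F - ε ≤ ν ((g * ·) ⁻¹' A) := by
  induction hg using Submonoid.closure_induction with
  | mem g hg =>
    intro ε hε
    have hm : 0 < μ.real {g} := by
      rw [measureReal_def]
      exact ENNReal.toReal_pos hg (measure_ne_top _ _)
    have hm1 : μ.real {g} ≤ 1 := measureReal_le_one
    -- The losses to absorb are the defect of ν A, the tail of μ, and the excess of the other
    -- translates over F: at most 3η altogether, to be divided by the mass of g.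
    set η := μ.real {g} * ε / 4 with hη
    have hη0 : 0 < η := by positivity
    obtain ⟨S, hS⟩ := exists_finset_one_sub_le μ hη0
    obtain ⟨D, hD⟩ := hF η hη0
    classical
    set T := insert g S
    have hT : 1 - η ≤ ∑ h ∈ T, μ.real {h} := hS.trans
      (Finset.sum_le_sum_of_subset_of_nonneg (Finset.subset_insert _ _) fun _ _ _ =>
        measureReal_nonneg)
    have hT1 : ∑ h ∈ T, μ.real {h} ≤ 1 := by
      have := hν.sum_le Set.univ T
      simp only [Set.preimage_univ, hν.univ, mul_one] at this
      exact this
    refine ⟨η, hη0, D + ∑ h ∈ T, 2 * dist (h • o) o, fun A hA hAF => ?_⟩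
    have hfar : ∀ h ∈ T, ν ((h * ·) ⁻¹' A) ≤ F + η := fun h hh => by
      refine hD _ ((hA.preimage_mul_left h).mono ?_)
      have := Finset.single_le_sum (f := fun h => 2 * dist (h • o) o) (fun i _ => by positivity) hh
      linarith
    have hFη : 0 ≤ F + η := (hν.nonneg _).trans (hfar g (Finset.mem_insert_self _ _))
    have h1 := hν.le_sum_add A T
    have hgT : g ∈ T := Finset.mem_insert_self _ _
    rw [← Finset.add_sum_erase T _ hgT] at h1
    have h2 : ∑ h ∈ T.erase g, μ.real {h} * ν ((h * ·) ⁻¹' A) ≤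
        (∑ h ∈ T.erase g, μ.real {h}) * (F + η) := by
      rw [Finset.sum_mul]
      exact Finset.sum_le_sum fun h hh =>
        mul_le_mul_of_nonneg_left (hfar h (Finset.mem_of_mem_erase hh)) measureReal_nonneg
    have h3 : ∑ h ∈ T.erase g, μ.real {h} ≤ 1 - μ.real {g} := by
      rw [← Finset.add_sum_erase T _ hgT] at hT1
      linarith
    have h4 := mul_le_mul_of_nonneg_right h3 hFη
    have h5 : μ.real {g} * (F - ε) ≤ μ.real {g} * ν ((g * ·) ⁻¹' A) := by
      have : (1 - μ.real {g}) * η ≤ η := by nlinarith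
      nlinarith
    exact le_of_mul_le_mul_left h5 hm
  | one =>
    intro ε hε
    exact ⟨ε, hε, 0, fun A _ hA => by simpa using hA⟩
  | mul g h _ _ ihg ihh =>
    intro ε hε
    obtain ⟨δ, hδ, D, hD⟩ := ihh ε hε
    obtain ⟨δ', hδ', D', hD'⟩ := ihg δ hδ
    refine ⟨δ', hδ', max D' (D + 2 * dist (g • o) o), fun A hA hAF => ?_⟩
    have h1 := hD' A (hA.mono (le_max_left _ _)) hAF
    have h2 := hD _ ((hA.mono (le_max_right _ _)).preimage_mul_left g |>.mono (by linarith)) h1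
    rw [Set.preimage_preimage] at h2
    simpa only [mul_assoc] using h2

theorem IsStationaryMean.le_preimage_of_finset (hν : IsStationaryMean μ ν) {F : ℝ}
    (hF : ∀ η > 0, ∃ D, ∀ A : Set G, IsFar o D A → ν A ≤ F + η) {ε : ℝ} (hε : 0 < ε)
    (T : Finset G) (hT : ∀ g ∈ T, g ∈ Submonoid.closure (atoms μ)) :
    ∃ δ > 0, ∃ D, ∀ A : Set G, IsFar o D A → F - δ ≤ ν A →
      ∀ g ∈ T, F - ε ≤ ν ((g * ·) ⁻¹' A) := by
  classical
  induction T using Finset.induction_on with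
  | empty => exact ⟨1, one_pos, 0, by simp⟩
  | insert g T _ ih =>
    obtain ⟨δ, hδ, D, hD⟩ := ih fun g hg => hT g (Finset.mem_insert_of_mem hg)
    obtain ⟨δ', hδ', D', hD'⟩ :=
      hν.le_preimage_of_mem_closure hF (hT g (Finset.mem_insert_self _ _)) ε hε
    refine ⟨min δ δ', lt_min hδ hδ', max D D', fun A hA hAF h hh => ?_⟩
    rcases Finset.mem_insert.1 hh with rfl | hh
    · exact hD' A (hA.mono (le_max_right _ _)) (by linarith [min_le_right δ δ'])
    · exact hD A (hA.mono (le_max_left _ _)) (by linarith [min_le_left δ δ']) h hh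

/-- Stationary means give small mass to far sets. -/
theorem IsStationaryMean.exists_le_of_isFar (hν : IsStationaryMean μ ν) {c : Bool → G}
    (hc : ∀ j, c j ∈ Submonoid.closure (atoms μ)) {D₀ : ℝ}
    (hD₀ : ∀ A : Set G, IsFar o D₀ A → ∃ j, ∀ m n : ℕ, m ≠ n →
      Disjoint ((c j ^ m * ·) ⁻¹' A) ((c j ^ n * ·) ⁻¹' A)) :
    ∀ ε > 0, ∃ D, ∀ A : Set G, IsFar o D A → ν A ≤ ε := by
  set B : Set ℝ := {t | ∃ D, ∀ A : Set G, IsFar o D A → ν A ≤ t} with hB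
  set F := sInf B with hFdef
  have hBbdd : BddBelow B := ⟨0, fun t ⟨D, hD⟩ => by
    have := hD ∅ (by intro x hx; exact hx.elim)
    rwa [hν.empty] at this⟩
  have hBne : B.Nonempty := ⟨1, 0, fun A _ => hν.le_one A⟩
  have hF : ∀ η > 0, ∃ D, ∀ A : Set G, IsFar o D A → ν A ≤ F + η := fun η hη => by
    obtain ⟨t, ⟨D, hD⟩, ht⟩ := exists_lt_of_csInf_lt hBne (show sInf B < F + η by linarith)
    exact ⟨D, fun A hA => (hD A hA).trans ht.le⟩
  have hF' : ∀ D, ∀ δ > 0, ∃ A : Set G, IsFar o D A ∧ F - δ ≤ ν A := fun D δ hδ => by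
    by_contra hcon
    push Not at hcon
    have : F ≤ F - δ := csInf_le hBbdd ⟨D, fun A hA => (hcon A hA).le⟩
    linarith
  suffices h : F ≤ 0 by
    intro ε hε
    obtain ⟨D, hD⟩ := hF ε hε
    exact ⟨D, fun A hA => (hD A hA).trans (by linarith)⟩
  by_contra hFpos
  push Not at hFpos
  -- N disjoint translates of mean at least F/2 would have total mean exceeding 1.
  obtain ⟨N, hN⟩ := exists_nat_gt (2 / F)
  classical
  set T : Finset G := (Finset.univ ×ˢ Finset.range N).image fun p : Bool × ℕ => c p.1 ^ p.2
  obtain ⟨δ, hδ, D, hD⟩ := hν.le_preimage_of_finset hF (half_pos hFpos) T (fun g hg => by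
    obtain ⟨p, -, rfl⟩ := Finset.mem_image.1 hg
    exact pow_mem (hc _) _)
  obtain ⟨A, hA, hAF⟩ := hF' (max D D₀) δ hδ
  obtain ⟨j, hj⟩ := hD₀ A (hA.mono (le_max_right _ _))
  have h1 := hν.sum_range_le_one (A := fun n => (c j ^ n * ·) ⁻¹' A) (fun m n hmn => hj m n hmn) N
  have h2 : ∑ n ∈ Finset.range N, F / 2 ≤ ∑ n ∈ Finset.range N, ν ((c j ^ n * ·) ⁻¹' A) :=
    Finset.sum_le_sum fun n hn => by
      have := hD A (hA.mono (le_max_left _ _)) hAF (c j ^ n)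
        (Finset.mem_image.2 ⟨(j, n), by simpa using hn, rfl⟩)
      linarith
  rw [Finset.sum_const, Finset.card_range, nsmul_eq_mul] at h2
  rw [div_lt_iff₀ hFpos] at hN
  linarith

end FarSets

/-! ### Independence and the zero-one law for i.i.d. sequences -/

section ProductMeasure

variable {ι G : Type*} [MeasurableSpace G] [Nonempty G]

/-- An event which only depends on the coordinates in `U` is measurable with respect to them. -/
theorem measurableSet_iSup_of_dependsOn {U : Set ι} {A : Set (ι → G)} (hA : MeasurableSet A)
    (hAU : DependsOn (· ∈ A) U) :
    MeasurableSet[⨆ i ∈ U, MeasurableSpace.comap (fun ω : ι → G => ω i) inferInstance] A := by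
  classical
  obtain ⟨x₀⟩ := ‹Nonempty G›
  have hm : @Measurable _ _
      (⨆ i ∈ U, MeasurableSpace.comap (fun ω : ι → G => ω i) inferInstance) _
      (fun (ω : ι → G) (i : ι) => if i ∈ U then ω i else x₀) := by
    refine @measurable_pi_lambda _ _ _ (_) _ _ fun i => ?_
    by_cases hi : i ∈ U
    · simp only [hi, if_true]
      exact Measurable.of_comap_le (le_iSup₂_of_le i hi le_rfl)
    · simp only [hi, if_false]
      exact @measurable_const _ _ _ (_) _
  have : A = (fun (ω : ι → G) (i : ι) => if i ∈ U then ω i else x₀) ⁻¹' A := by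
    ext ω
    exact iff_of_eq (hAU fun i hi => by simp [hi])
  rw [this]
  exact hm hA

omit [Nonempty G] in
theorem iIndep_coordinates (μ : Measure G) [IsProbabilityMeasure μ] :
    ProbabilityTheory.iIndep
      (fun i : ι => MeasurableSpace.comap (fun ω : ι → G => ω i) inferInstance)
      (Measure.infinitePi fun _ : ι => μ) :=
  (ProbabilityTheory.iIndepFun_infinitePi (X := fun _ x => x) fun _ => measurable_id).iIndep

/-- Events depending on disjoint sets of coordinates of an i.i.d. family are independent. -/
theorem infinitePi_inter_of_dependsOn (μ : Measure G) [IsProbabilityMeasure μ] {S T : Set ι}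
    (hST : Disjoint S T) {A B : Set (ι → G)} (hA : MeasurableSet A) (hB : MeasurableSet B)
    (hAS : DependsOn (· ∈ A) S) (hBT : DependsOn (· ∈ B) T) :
    Measure.infinitePi (fun _ : ι => μ) (A ∩ B) =
      Measure.infinitePi (fun _ : ι => μ) A * Measure.infinitePi (fun _ : ι => μ) B :=
  (ProbabilityTheory.Indep_iff _ _ _).1 (ProbabilityTheory.indep_iSup_of_disjoint
    (fun i => (measurable_pi_apply i).comap_le) (iIndep_coordinates μ) hST) A B
    (measurableSet_iSup_of_dependsOn hA hAS) (measurableSet_iSup_of_dependsOn hB hBT)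

/-- **Kolmogorov's zero-one law** for events which do not depend on finitely many coordinates. -/
theorem infinitePi_eq_zero_or_one (μ : Measure G) [IsProbabilityMeasure μ] {A : Set (ℕ → G)}
    (hA : MeasurableSet A) (hdep : ∀ K, DependsOn (· ∈ A) {i | K ≤ i}) :
    Measure.infinitePi (fun _ : ℕ => μ) A = 0 ∨ Measure.infinitePi (fun _ : ℕ => μ) A = 1 := by
  refine ProbabilityTheory.measure_zero_or_one_of_measurableSet_limsup_atTop
    (fun i => (measurable_pi_apply i).comap_le) (iIndep_coordinates μ) ?_
  rw [limsup_eq_iInf_iSup_of_nat, MeasurableSpace.measurableSet_iInf]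
  exact fun K => measurableSet_iSup_of_dependsOn hA (hdep K)

omit [Nonempty G] in
theorem measurePreserving_reindex (μ : Measure G) [IsProbabilityMeasure μ] {κ : Type*} {f : κ → ι}
    (hf : Function.Injective f) :
    MeasurePreserving (fun (ω : ι → G) i => ω (f i)) (Measure.infinitePi fun _ : ι => μ)
      (Measure.infinitePi fun _ : κ => μ) :=
  ⟨measurable_pi_lambda _ fun _ => measurable_pi_apply _,
    Measure.map_infinitePi_infinitePi_of_inj hf⟩

end ProductMeasure

/-! ### The one-sided walk and a maximal inequality -/

section Walk

variable {G : Type*} [Group G]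

/-- The one-sided random walk with steps `ξ`. -/
def walk (ξ : ℕ → G) (n : ℕ) : G := ((List.range n).map ξ).prod

@[simp] theorem walk_zero (ξ : ℕ → G) : walk ξ 0 = 1 := by simp [walk]

theorem walk_succ (ξ : ℕ → G) (n : ℕ) : walk ξ (n + 1) = walk ξ n * ξ n := by
  simp [walk, List.range_succ]

theorem walk_add (ξ : ℕ → G) (m n : ℕ) :
    walk ξ (m + n) = walk ξ m * walk (fun i => ξ (m + i)) n := by
  induction n with
  | zero => simp
  | succ n ih => rw [← add_assoc, walk_succ, ih, walk_succ, mul_assoc]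

theorem walk_congr {ξ ζ : ℕ → G} {n : ℕ} (h : ∀ i < n, ξ i = ζ i) : walk ξ n = walk ζ n := by
  unfold walk
  congr 1
  exact List.map_congr_left fun i hi => h i (List.mem_range.1 hi)

variable [MeasurableSpace G] [Countable G] [DiscreteMeasurableSpace G]

theorem measurable_walk (n : ℕ) : Measurable fun ξ : ℕ → G => walk ξ n := by
  induction n with
  | zero => simp only [walk_zero]; exact measurable_const
  | succ n ih =>
    simp only [walk_succ]
    exact (Measurable.of_discrete (f := fun p : G × G => p.1 * p.2)).comp
      (ih.prodMk (measurable_pi_apply n))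

variable (μ : Measure G) [IsProbabilityMeasure μ]

theorem infinitePi_first_step (S : G → Set (ℕ → G)) (hS : ∀ g, MeasurableSet (S g)) :
    Measure.infinitePi (fun _ : ℕ => μ) {ξ | (fun i => ξ (1 + i)) ∈ S (ξ 0)} =
      ∫⁻ g, Measure.infinitePi (fun _ : ℕ => μ) (S g) ∂μ := by
  have hshift := measurePreserving_reindex μ (f := fun i : ℕ => 1 + i) (add_right_injective 1)
  have hfirst : ∀ g : G, MeasurableSet {ξ : ℕ → G | ξ 0 = g} := fun g =>
    (measurable_pi_apply 0 : Measurable fun ξ : ℕ → G => ξ 0) (MeasurableSet.of_discrete (s := {g}))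
  have hset : {ξ : ℕ → G | (fun i => ξ (1 + i)) ∈ S (ξ 0)} =
      ⋃ g, {ξ | ξ 0 = g} ∩ (fun (ξ : ℕ → G) i => ξ (1 + i)) ⁻¹' S g := by
    ext ξ
    simp
  rw [hset, measure_iUnion, lintegral_countable']
  · refine tsum_congr fun g => ?_
    rw [infinitePi_inter_of_dependsOn μ (S := {0}) (T := {i | 1 ≤ i}) (by simp) (hfirst g)
      (hshift.measurable (hS g)), hshift.measure_preimage (hS g).nullMeasurableSet, mul_comm]
    · congr 1
      have := (measurePreserving_eval_infinitePi (fun _ : ℕ => μ) 0).measure_preimage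
        (MeasurableSet.of_discrete (s := {g})).nullMeasurableSet
      exact this
    · intro x y h
      simp [h 0 rfl]
    · intro x y h
      have : (fun i => x (1 + i)) = fun i => y (1 + i) := funext fun i => h _ (by simp)
      simp only [Set.mem_preimage, this]
  · intro g h hgh
    refine Set.disjoint_left.2 fun ξ h1 h2 => hgh ?_
    rw [← h1.1, ← h2.1]
  · exact fun g => (hfirst g).inter (hshift.measurable (hS g))

theorem measurableSet_exists_walk_mem (x : G) (B : Set G) :
    MeasurableSet {ξ : ℕ → G | ∃ n, x * walk ξ n ∈ B} := by
  rw [Set.ofPred_exists]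
  exact MeasurableSet.iUnion fun n =>
    measurable_walk n (MeasurableSet.of_discrete (s := {y | x * y ∈ B}))

/-- A nonnegative `μ`-superharmonic function which is at least `1` on `B` bounds the probability
that the random walk hits `B`. -/
theorem measure_exists_walk_mem_le {V : G → ℝ≥0∞} {B : Set G} (hB : ∀ x ∈ B, 1 ≤ V x)
    (hV : ∀ x, ∫⁻ g, V (x * g) ∂μ ≤ V x) (x : G) :
    Measure.infinitePi (fun _ : ℕ => μ) {ξ | ∃ n, x * walk ξ n ∈ B} ≤ V x := by
  have hmeas : ∀ N x, MeasurableSet {ξ : ℕ → G | ∃ n ≤ N, x * walk ξ n ∈ B} := fun N x => by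
    have : {ξ : ℕ → G | ∃ n ≤ N, x * walk ξ n ∈ B} =
        ⋃ n, ⋃ _ : n ≤ N, (fun ξ => walk ξ n) ⁻¹' {y | x * y ∈ B} := by
      ext ξ
      simp
    rw [this]
    exact MeasurableSet.iUnion fun n => MeasurableSet.iUnion fun _ =>
      measurable_walk n MeasurableSet.of_discrete
  -- Induction on the time horizon, conditioning on the first step, replaces optional stopping.
  have key : ∀ N x, Measure.infinitePi (fun _ : ℕ => μ)
      {ξ | ∃ n ≤ N, x * walk ξ n ∈ B} ≤ V x := by
    intro N
    induction N with
    | zero =>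
      intro x
      by_cases hx : x ∈ B
      · exact prob_le_one.trans (hB x hx)
      · simp [hx]
    | succ N ih =>
      intro x
      by_cases hx : x ∈ B
      · exact prob_le_one.trans (hB x hx)
      · have hset : {ξ : ℕ → G | ∃ n ≤ N + 1, x * walk ξ n ∈ B} =
            {ξ | (fun i => ξ (1 + i)) ∈ {ζ : ℕ → G | ∃ n ≤ N, x * ξ 0 * walk ζ n ∈ B}} := by
          ext ξ
          have h1 : ∀ n, x * walk ξ (1 + n) = x * ξ 0 * walk (fun i => ξ (1 + i)) n := fun n => by
            rw [walk_add, mul_assoc]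
            simp [walk]
          constructor
          · rintro ⟨n, hn, h⟩
            rcases n with _ | n
            · simp [hx] at h
            · exact ⟨n, by omega, by rw [← h1, add_comm]; exact h⟩
          · rintro ⟨n, hn, h⟩
            exact ⟨1 + n, by omega, by rw [h1]; exact h⟩
        rw [hset, infinitePi_first_step μ (fun g => {ζ | ∃ n ≤ N, x * g * walk ζ n ∈ B})
          fun g => hmeas N _]
        exact (lintegral_mono fun g => ih (x * g)).trans (hV x)
  have hU : {ξ : ℕ → G | ∃ n, x * walk ξ n ∈ B} = ⋃ N, {ξ | ∃ n ≤ N, x * walk ξ n ∈ B} := by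
    ext ξ
    simp only [Set.mem_ofPred_eq, Set.mem_iUnion]
    exact ⟨fun ⟨n, hn⟩ => ⟨n, n, le_rfl, hn⟩, fun ⟨_, n, _, hn⟩ => ⟨n, hn⟩⟩
  rw [hU, Monotone.measure_iUnion]
  · exact iSup_le fun N => key N x
  · intro M N hMN ξ ⟨n, hn, h⟩
    exact ⟨n, hn.trans hMN, h⟩

/-- Stationarity as superharmonicity of x ↦ ν(x⁻¹A)/r; the integral is a supremum of finite sums, so
the one-sided finite inequality is enough. -/
theorem IsStationaryMean.lintegral_le {μ : Measure G} {ν : Set G → ℝ} [IsProbabilityMeasure μ]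
    (hν : IsStationaryMean μ ν) (A : Set G) {r : ℝ} (hr : 0 < r) (x : G) :
    ∫⁻ g, ENNReal.ofReal (ν ((x * g * ·) ⁻¹' A) / r) ∂μ ≤
      ENNReal.ofReal (ν ((x * ·) ⁻¹' A) / r) := by
  rw [lintegral_countable']
  rw [ENNReal.tsum_eq_iSup_sum]
  refine iSup_le fun S => ?_
  have h := hν.sum_le ((x * ·) ⁻¹' A) S
  calc ∑ g ∈ S, ENNReal.ofReal (ν ((x * g * ·) ⁻¹' A) / r) * μ {g}
      = ENNReal.ofReal (∑ g ∈ S, ν ((x * g * ·) ⁻¹' A) / r * μ.real {g}) := by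
        rw [ENNReal.ofReal_sum_of_nonneg fun g _ =>
          mul_nonneg (div_nonneg (hν.nonneg _) hr.le) measureReal_nonneg]
        refine Finset.sum_congr rfl fun g _ => ?_
        rw [ENNReal.ofReal_mul (div_nonneg (hν.nonneg _) hr.le), measureReal_def,
          ENNReal.ofReal_toReal (measure_ne_top _ _)]
    _ ≤ _ := by
        refine ENNReal.ofReal_le_ofReal ?_
        rw [le_div_iff₀ hr, Finset.sum_mul]
        refine le_trans (Finset.sum_le_sum fun g _ => le_of_eq ?_) h
        rw [Set.preimage_preimage]
        simp only [mul_assoc]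
        field_simp

end Walk

/-! ### The walk rarely drifts along an axis -/

section Hitting

variable {X : Type*} [MetricSpace X] {G : Type*} [Group G] [MulAction G X] [IsIsometricSMul G X]
  [MeasurableSpace G] [Countable G] [DiscreteMeasurableSpace G]
  {μ : Measure G} [IsProbabilityMeasure μ] {o : X}

/-- The random walk started at `h` is unlikely to ever move far along an axis. -/
theorem IsAxisProjection.exists_measure_exists_le {c : G} {idx : X → ℤ} {Q : ℝ}
    (hidx : IsAxisProjection o c idx Q) {ν : Set G → ℝ} (hν : IsStationaryMean μ ν)
    (hfar : ∀ ε > 0, ∃ D, ∀ A : Set G, IsFar o D A → ν A ≤ ε) {ε : ℝ} (hε : 0 < ε) :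
    ∃ D : ℝ, ∀ h : G, Measure.infinitePi (fun _ : ℕ => μ)
      {ξ | ∃ n, D ≤ |(idx (h • walk ξ n • o) : ℝ) - idx (h • o)|} ≤ ENNReal.ofReal ε := by
  set η := min (ε / 4) (1 / 4) with hη
  have hη0 : 0 < η := lt_min (by positivity) (by norm_num)
  have hη1 : η ≤ 1 / 4 := min_le_right _ _
  have hη2 : η ≤ ε / 4 := min_le_left _ _
  obtain ⟨D', hD'⟩ := hfar η hη0
  obtain ⟨D, hD⟩ := hidx.far D'
  set U : G → Set G := fun h => {y | D ≤ |(idx (h • y • o) : ℝ) - idx (h • o)|} with hU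
  have hνU : ∀ h, ν (U h) ≤ 2 * η := fun h => by
    set U₁ : Set G := {y | (idx (h • o) : ℝ) + D ≤ idx (h • y • o)}
    set U₂ : Set G := {y | (idx (h • y • o) : ℝ) + D ≤ idx (h • o)}
    have h1 : U h ⊆ U₁ ∪ U₂ := fun y hy => by
      rcases le_abs.1 (show D ≤ |(idx (h • y • o) : ℝ) - idx (h • o)| from hy) with h | h
      · left; simp only [U₁, Set.mem_ofPred_eq]; linarith
      · right; simp only [U₂, Set.mem_ofPred_eq]; linarith
    have h2 : ν U₁ ≤ η := hD' _ fun x hx y hy => by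
      simpa only [dist_smul] using hD (h • o) (h • x • o) (h • y • o) (Or.inl ⟨hx, hy⟩)
    have h3 : ν U₂ ≤ η := hD' _ fun x hx y hy => by
      simpa only [dist_smul] using hD (h • o) (h • x • o) (h • y • o) (Or.inr ⟨hx, hy⟩)
    linarith [hν.mono h1, hν.union_le U₁ U₂]
  -- The function V(x) = 2ν(x⁻¹U_h) has V(1) ≤ 4η ≤ ε, so it remains to see V ≥ 1 wherever the index
  -- has moved by 2D.
  refine ⟨2 * D, fun h => ?_⟩
  have hb := measure_exists_walk_mem_le μ
    (V := fun x => ENNReal.ofReal (ν ((x * ·) ⁻¹' U h) / (1 / 2)))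
    (B := {y | 2 * D ≤ |(idx (h • y • o) : ℝ) - idx (h • o)|}) (fun x hx => ?_)
    (hν.lintegral_le (U h) (by norm_num)) 1
  · simp only [one_mul] at hb
    refine hb.trans (ENNReal.ofReal_le_ofReal ?_)
    have := hνU h
    simp only [Set.preimage_id']
    linarith
  · rw [← ENNReal.ofReal_one]
    refine ENNReal.ofReal_le_ofReal ?_
    rw [le_div_iff₀ (by norm_num), one_mul]
    -- Having moved by 2D, a further y that ends within D of the initial index must move by more
    -- than D as seen from hx, which has small mean.
    have h1 : ((x * ·) ⁻¹' U h)ᶜ ⊆ U (h * x) := fun y hy => by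
      simp only [hU, Set.mem_compl_iff, Set.mem_preimage, Set.mem_ofPred_eq, not_le, mul_smul]
        at hy hx ⊢
      have h2 := abs_sub_abs_le_abs_sub ((idx (h • x • o) : ℝ) - idx (h • o))
        ((idx (h • x • y • o) : ℝ) - idx (h • o))
      rw [sub_sub_sub_cancel_right, abs_sub_comm (idx (h • x • o) : ℝ)
        (idx (h • x • y • o))] at h2
      linarith
    have h2 := hν.mono h1
    rw [hν.compl] at h2
    linarith [hνU (h * x)]

end Hitting

/-! ### Alignment of backward walk, jump and forward walk -/

section AlignedWalks

variable {X : Type*} [MetricSpace X] {G : Type*} [Group G] [MulAction G X] {o : X}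

/-- The projection of y lies boundedly close to o, so the reversed triangle inequality along the
axis can be based at o. -/
theorem IsAxisProjection.dist_add_dist_le {c : G} {idx : X → ℤ} {Q R : ℝ}
    (h : IsAxisProjection o c idx Q) {x y : X} (hy : |(idx y : ℝ)| ≤ R)
    (hxy : Q ≤ |(idx x : ℝ) - idx y|) :
    dist x o + dist y o ≤ dist x y + (Q + 2 * (Q * R + Q)) := by
  have h1 := h.le_dist x y hxy
  have h2 := dist_le_of_abs_index_le h hy
  have h3 := dist_triangle4 x (c ^ idx x • o) (c ^ idx y • o) o
  have h4 := dist_triangle y (c ^ idx y • o) o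
  rw [dist_comm y (c ^ idx y • o)] at h4
  linarith

variable [MeasurableSpace G] [Countable G] [DiscreteMeasurableSpace G]

/-- The event that the walk is at `β` at time `ℓ` and stays within `L` of `o` until then. -/
def startSet (o : X) (β : G) (ℓ : ℕ) (L : ℝ) : Set (ℕ → G) :=
  {ξ | walk ξ ℓ = β ∧ ∀ i ≤ ℓ, dist (walk ξ i • o) o ≤ L}

theorem measurableSet_startSet (o : X) (β : G) (ℓ : ℕ) (L : ℝ) :
    MeasurableSet (startSet o β ℓ L) := by
  have : startSet o β ℓ L = (fun ξ => walk ξ ℓ) ⁻¹' {β} ∩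
      ⋂ i, ⋂ _ : i ≤ ℓ, (fun ξ => walk ξ i) ⁻¹' {g | dist (g • o) o ≤ L} := by
    ext ξ
    simp [startSet]
  rw [this]
  exact (measurable_walk ℓ MeasurableSet.of_discrete).inter (MeasurableSet.iInter fun i =>
    MeasurableSet.iInter fun _ => measurable_walk i MeasurableSet.of_discrete)

omit [MeasurableSpace G] [Countable G] [DiscreteMeasurableSpace G] in
theorem dependsOn_startSet (o : X) (β : G) (ℓ : ℕ) (L : ℝ) :
    DependsOn (· ∈ startSet o β ℓ L) {i | i < ℓ} := by
  intro ξ ζ h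
  have hw : ∀ i ≤ ℓ, walk ξ i = walk ζ i := fun i hi =>
    walk_congr fun k hk => h k (lt_of_lt_of_le hk hi)
  simp only [startSet, Set.mem_ofPred_eq, hw ℓ le_rfl, eq_iff_iff]
  refine and_congr_right fun _ => forall₂_congr fun i hi => by rw [hw i hi]

variable (μ : Measure G) [IsProbabilityMeasure μ]

omit [Countable G] [DiscreteMeasurableSpace G] in
theorem measure_inter_shift {A S : Set (ℕ → G)} {ℓ : ℕ} (hA : MeasurableSet A)
    (hAℓ : DependsOn (· ∈ A) {i | i < ℓ}) (hS : MeasurableSet S) :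
    Measure.infinitePi (fun _ : ℕ => μ) (A ∩ (fun (ξ : ℕ → G) i => ξ (ℓ + i)) ⁻¹' S) =
      Measure.infinitePi (fun _ : ℕ => μ) A * Measure.infinitePi (fun _ : ℕ => μ) S := by
  have hshift := measurePreserving_reindex μ (f := fun i : ℕ => ℓ + i) (add_right_injective ℓ)
  rw [infinitePi_inter_of_dependsOn μ (S := {i | i < ℓ}) (T := {i | ℓ ≤ i}) _ hA
    (hshift.measurable hS) hAℓ, hshift.measure_preimage hS.nullMeasurableSet]
  · intro x y h
    have : (fun i => x (ℓ + i)) = fun i => y (ℓ + i) := funext fun i => h _ (by simp)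
    simp only [Set.mem_preimage, this]
  · exact Set.disjoint_left.2 fun i (hi : i < ℓ) (hi' : ℓ ≤ i) => absurd hi' (not_le.2 hi)

theorem exists_measure_walk_eq_pos {β : G} (hβ : β ∈ Submonoid.closure (atoms μ)) :
    ∃ ℓ, 0 < Measure.infinitePi (fun _ : ℕ => μ) {ξ | walk ξ ℓ = β} := by
  have hmeas : ∀ ℓ (β : G), MeasurableSet {ξ : ℕ → G | walk ξ ℓ = β} := fun ℓ β =>
    measurable_walk ℓ (MeasurableSet.of_discrete (s := {β}))
  induction hβ using Submonoid.closure_induction with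
  | mem g hg =>
    refine ⟨1, ?_⟩
    have h := (measurePreserving_eval_infinitePi (fun _ : ℕ => μ) 0).measure_preimage
      (MeasurableSet.of_discrete (s := {g})).nullMeasurableSet
    have hset : {ξ : ℕ → G | walk ξ 1 = g} = (Function.eval 0 : (ℕ → G) → G) ⁻¹' {g} := by
      ext ξ
      simp [walk]
    rw [hset, h]
    exact pos_iff_ne_zero.2 hg
  | one => exact ⟨0, by simp⟩
  | mul g h _ _ ihg ihh =>
    obtain ⟨ℓ, hℓ⟩ := ihg
    obtain ⟨ℓ', hℓ'⟩ := ihh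
    refine ⟨ℓ + ℓ', (ENNReal.mul_pos hℓ.ne' hℓ'.ne').trans_le ?_⟩
    rw [← measure_inter_shift μ (hmeas ℓ g) _ (hmeas ℓ' h)]
    · refine measure_mono fun ξ hξ => ?_
      rw [Set.mem_ofPred_eq, walk_add]
      exact congrArg₂ _ hξ.1 hξ.2
    · intro ξ ζ h
      simp only [Set.mem_ofPred_eq, walk_congr (ξ := ξ) (ζ := ζ) (n := ℓ) h]

theorem exists_measure_startSet_pos (o : X) {β : G} (hβ : β ∈ Submonoid.closure (atoms μ)) :
    ∃ ℓ, ∃ L : ℝ, 0 < Measure.infinitePi (fun _ : ℕ => μ) (startSet o β ℓ L) := by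
  obtain ⟨ℓ, hℓ⟩ := exists_measure_walk_eq_pos μ hβ
  refine ⟨ℓ, ?_⟩
  by_contra hc
  push Not at hc
  refine hℓ.ne' (measure_mono_null (t := ⋃ L : ℕ, startSet o β ℓ L) (fun ξ hξ => ?_)
    (measure_iUnion_null fun L => le_zero_iff.1 (hc L)))
  obtain ⟨L, hL⟩ := exists_nat_ge (∑ i ∈ Finset.range (ℓ + 1), dist (walk ξ i • o) o)
  refine Set.mem_iUnion.2 ⟨L, hξ, fun i hi => le_trans ?_ hL⟩
  exact Finset.single_le_sum (f := fun i => dist (walk ξ i • o) o) (fun _ _ => dist_nonneg)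
    (Finset.mem_range.2 (by omega))

variable [IsIsometricSMul G X]

/-- The inverse case serves the backward walk, whose support generates the inverses. The axes are
the same, with negative exponents in the disjointness property. -/
theorem IsSchottkyPair.exists_measure_exists_le {c : Bool → G} {idx : Bool → X → ℤ} {Q : ℝ}
    (h : IsSchottkyPair o c idx Q) {c' : Bool → G}
    (hc' : (∀ j, c' j = c j) ∨ ∀ j, c' j = (c j)⁻¹)
    (hmem : ∀ j, c' j ∈ Submonoid.closure (atoms μ)) {ε : ℝ} (hε : 0 < ε) :
    ∃ D : ℝ, 0 ≤ D ∧ ∀ (j : Bool) (h : G), Measure.infinitePi (fun _ : ℕ => μ)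
      {ξ | ∃ n, D ≤ |(idx j (h • walk ξ n • o) : ℝ) - idx j (h • o)|} ≤ ENNReal.ofReal ε := by
  obtain ⟨ν, hν⟩ := exists_isStationaryMean μ
  obtain ⟨k, D₀, hdisj⟩ := h.exists_disjoint
  have hfar := hν.exists_le_of_isFar (o := o) (c := fun j => c' j ^ k)
    (fun j => pow_mem (hmem j) k) (D₀ := D₀) fun A hA => by
      obtain ⟨j, hj⟩ := hdisj A hA
      refine ⟨j, fun m n hmn => ?_⟩
      rcases hc' with hc' | hc'
      · simpa only [hc', zpow_mul, zpow_natCast] using hj m n (by exact_mod_cast hmn)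
      · simpa only [hc', zpow_mul, zpow_natCast, zpow_neg, inv_pow] using
          hj (-m) (-n) (by simpa using hmn)
  choose D hD using fun j => (h.axis j).exists_measure_exists_le hν hfar hε
  refine ⟨max 0 (max (D true) (D false)), le_max_left _ _, fun j g => ?_⟩
  refine (measure_mono ?_).trans (hD j g)
  rintro ξ ⟨n, hn⟩
  refine ⟨n, le_trans ?_ hn⟩
  cases j
  · exact (le_max_right _ _).trans (le_max_right _ _)
  · exact (le_max_left _ _).trans (le_max_right _ _)

theorem half_le_of_compl_le {Ω : Type*} [MeasurableSpace Ω] {P : Measure Ω}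
    [IsProbabilityMeasure P] {S : Set Ω} (hS : MeasurableSet S) (h : P Sᶜ ≤ 2⁻¹) : 2⁻¹ ≤ P S := by
  have h1 := prob_add_prob_compl (μ := P) hS
  rw [← ENNReal.one_sub_inv_two, tsub_le_iff_right, ← h1]
  gcongr

omit [MeasurableSpace G] [Countable G] [DiscreteMeasurableSpace G] [IsIsometricSMul G X] in
-- Times during the prescribed beginning can be replaced by time ℓ, so estimates known only after it
-- extend to all times.
theorem dist_walk_le_of_mem_startSet {β : G} {ℓ : ℕ} {L : ℝ} {ξ : ℕ → G}
    (hξ : ξ ∈ startSet o β ℓ L) (n : ℕ) :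
    ∃ i, dist (walk ξ n • o) (walk ξ (ℓ + i) • o) ≤ 2 * L := by
  have hL : 0 ≤ L := dist_nonneg.trans (hξ.2 0 (Nat.zero_le _))
  rcases le_total ℓ n with hn | hn
  · exact ⟨n - ℓ, by rw [Nat.add_sub_cancel' hn, dist_self]; positivity⟩
  · refine ⟨0, ?_⟩
    have := dist_triangle_right (walk ξ n • o) (walk ξ (ℓ + 0) • o) o
    have h1 : dist (walk ξ (ℓ + 0) • o) o ≤ L := hξ.2 ℓ le_rfl
    linarith [hξ.2 n hn]

/-- With probability bounded below, uniformly in `g`, the concatenation of a backward walk, a jump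
`g` and a forward walk is an almost geodesic at all times. -/
theorem IsSchottkyPair.exists_aligned {c : Bool → G} {idx : Bool → X → ℤ} {Q : ℝ}
    (h : IsSchottkyPair o c idx Q) (μ' : Measure G) [IsProbabilityMeasure μ']
    (hc : ∀ j, c j ∈ Submonoid.closure (atoms μ))
    (hc' : ∀ j, (c j)⁻¹ ∈ Submonoid.closure (atoms μ')) :
    ∃ (C : ℝ) (δ : ℝ≥0∞), 0 ≤ C ∧ 0 < δ ∧ ∀ g : G, ∃ F B : Set (ℕ → G),
      MeasurableSet F ∧ MeasurableSet B ∧ δ ≤ Measure.infinitePi (fun _ : ℕ => μ) F ∧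
      δ ≤ Measure.infinitePi (fun _ : ℕ => μ') B ∧ ∀ ξ ∈ F, ∀ ζ ∈ B, ∀ m n,
        dist (walk ζ m • o) o + dist (g • o) o + dist (walk ξ n • o) o ≤
          dist (walk ζ m • o) (g • walk ξ n • o) + C := by
  have hQ := (h.axis true).pos
  obtain ⟨D, hD0, hD⟩ := h.exists_measure_exists_le μ (c' := c) (Or.inl fun _ => rfl) hc
    (ε := 1 / 4) (by norm_num)
  obtain ⟨D', hD0', hD'⟩ := h.exists_measure_exists_le μ' (c' := fun j => (c j)⁻¹)
    (Or.inr fun _ => rfl) hc' (ε := 1 / 4) (by norm_num)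
  -- With this power the indices at the second junction, at most -p + Q + D' and at least -(Q + D),
  -- still differ by Q.
  obtain ⟨p, hp⟩ := exists_nat_ge (3 * Q + D + D')
  choose ℓ L hL using fun j => exists_measure_startSet_pos μ o (pow_mem (hc j) p)
  choose ℓ' L' hL' using fun j => exists_measure_startSet_pos μ' o (pow_mem (hc' j) p)
  set M : ℝ := max (max (L true) (L false)) (max (L' true) (L' false)) with hM
  have hLM : ∀ j, L j ≤ M := by rintro (_ | _) <;> simp [hM]
  have hLM' : ∀ j, L' j ≤ M := by rintro (_ | _) <;> simp [hM]
  set Pf := fun j => Measure.infinitePi (fun _ : ℕ => μ) (startSet o (c j ^ p) (ℓ j) (L j)) with hPf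
  set Pb := fun j => Measure.infinitePi (fun _ : ℕ => μ')
    (startSet o ((c j)⁻¹ ^ p) (ℓ' j) (L' j)) with hPb
  set δ₀ := min (min (Pf true) (Pf false)) (min (Pb true) (Pb false)) with hδ₀
  have hδ₀pos : 0 < δ₀ := lt_min (lt_min (hL _) (hL _)) (lt_min (hL' _) (hL' _))
  have hPfδ : ∀ j, δ₀ ≤ Pf j := by rintro (_ | _) <;> simp [hδ₀]
  have hPbδ : ∀ j, δ₀ ≤ Pb j := by rintro (_ | _) <;> simp [hδ₀]
  set C₀ : ℝ := (Q + 2 * (Q * Q + Q)) + (Q + 2 * (Q * (Q + D) + Q)) with hC₀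
  have hM0 : 0 ≤ |M| := abs_nonneg M
  -- Only four possible beginnings occur, so the constants do not depend on g. Two time replacements
  -- at cost 2M, each used twice, give 8|M|.
  refine ⟨C₀ + 8 * |M|, δ₀ * 2⁻¹, by positivity, ENNReal.mul_pos hδ₀pos.ne' (by simp), fun g => ?_⟩
  -- The axis `j` separates the forward walk from g⁻¹o. The axis `i` is chosen after it, so that the
  -- translated forward walk, once past its beginning, projects near o on axis `i`, from which the
  -- backward walk departs in the negative direction.
  obtain ⟨j, hj⟩ := h.exists_lt (g⁻¹ • o)
  obtain ⟨i, hi⟩ := h.exists_lt ((g * c j ^ p) • o)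
  have hmeas : ∀ (i : Bool) (x : G) (R : ℝ), MeasurableSet
      {ξ : ℕ → G | ∃ n, R ≤ |(idx i (x • walk ξ n • o) : ℝ) - idx i (x • o)|} := fun i x R => by
    simpa using measurableSet_exists_walk_mem 1
      {y : G | R ≤ |(idx i (x • y • o) : ℝ) - idx i (x • o)|}
  set S₁ := {ξ : ℕ → G | ∃ n, D ≤ |(idx j ((c j ^ p) • walk ξ n • o) : ℝ) - idx j ((c j ^ p) • o)|}
  set S₂ := {ξ : ℕ → G | ∃ n,
    D ≤ |(idx i ((g * c j ^ p) • walk ξ n • o) : ℝ) - idx i ((g * c j ^ p) • o)|}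
  set S₃ := {ξ : ℕ → G | ∃ n,
    D' ≤ |(idx i (((c i)⁻¹ ^ p) • walk ξ n • o) : ℝ) - idx i (((c i)⁻¹ ^ p) • o)|}
  have hquarter : ENNReal.ofReal (1 / 4) + ENNReal.ofReal (1 / 4) = 2⁻¹ := by
    rw [← ENNReal.ofReal_add (by norm_num) (by norm_num), ← ENNReal.ofReal_ofNat 2,
      ← ENNReal.ofReal_inv_of_pos (by norm_num)]
    norm_num
  have hm12 : MeasurableSet (S₁ ∪ S₂)ᶜ := ((hmeas _ _ _).union (hmeas _ _ _)).compl
  have hm3 : MeasurableSet S₃ᶜ := (hmeas _ _ _).compl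
  refine ⟨startSet o (c j ^ p) (ℓ j) (L j) ∩ (fun (ξ : ℕ → G) k => ξ (ℓ j + k)) ⁻¹' (S₁ ∪ S₂)ᶜ,
    startSet o ((c i)⁻¹ ^ p) (ℓ' i) (L' i) ∩ (fun (ξ : ℕ → G) k => ξ (ℓ' i + k)) ⁻¹' S₃ᶜ,
    (measurableSet_startSet _ _ _ _).inter ((measurePreserving_reindex μ
      (f := fun k : ℕ => ℓ j + k) (add_right_injective _)).measurable hm12),
    (measurableSet_startSet _ _ _ _).inter ((measurePreserving_reindex μ
      (f := fun k : ℕ => ℓ' i + k) (add_right_injective _)).measurable hm3), ?_, ?_, ?_⟩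
  · rw [measure_inter_shift μ (measurableSet_startSet _ _ _ _) (dependsOn_startSet _ _ _ _) hm12]
    refine mul_le_mul' (hPfδ j) (half_le_of_compl_le hm12 ?_)
    rw [compl_compl, ← hquarter]
    exact (measure_union_le _ _).trans (add_le_add (hD _ _) (hD _ _))
  · rw [measure_inter_shift μ' (measurableSet_startSet _ _ _ _) (dependsOn_startSet _ _ _ _) hm3]
    refine mul_le_mul' (hPbδ i) (half_le_of_compl_le hm3 ?_)
    rw [compl_compl, ← hquarter]
    exact (hD' _ _).trans le_self_add
  · rintro ξ ⟨hξ, hξS⟩ ζ ⟨hζ, hζS⟩ m n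
    simp only [Set.mem_preimage, Set.mem_compl_iff, Set.mem_union, S₁, S₂, S₃, Set.mem_ofPred_eq,
      not_or, not_exists, not_le] at hξS hζS
    have key : ∀ m n, dist (walk ζ (ℓ' i + m) • o) o + dist (g • o) o +
        dist (walk ξ (ℓ j + n) • o) o ≤
          dist (walk ζ (ℓ' i + m) • o) (g • walk ξ (ℓ j + n) • o) + C₀ := by
      intro m n
      have h1 := hξS.1 n
      have h2 := hξS.2 n
      have h3 := hζS m
      have hy : walk ξ (ℓ j + n) = c j ^ p * walk (fun k => ξ (ℓ j + k)) n := by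
        rw [walk_add, hξ.1]
      have hx : walk ζ (ℓ' i + m) = (c i)⁻¹ ^ p * walk (fun k => ζ (ℓ' i + k)) m := by
        rw [walk_add, hζ.1]
      rw [smul_smul, ← hy] at h1
      rw [smul_smul, mul_assoc, ← hy] at h2
      rw [smul_smul, ← hx] at h3
      have h4 := (h.axis j).abs_index_sub_le p
      have h5 := (h.axis i).abs_index_sub_le (-p)
      rw [zpow_natCast] at h4
      rw [zpow_neg, zpow_natCast, ← inv_pow] at h5
      push_cast at h4 h5
      rw [abs_lt] at h1 h2 h3 hi
      rw [abs_le] at h4 h5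
      have h6 := (h.axis j).dist_add_dist_le (x := walk ξ (ℓ j + n) • o) hj.le (by
        rw [abs_lt] at hj
        exact le_trans (by linarith) (le_abs_self _))
      have h7 := (h.axis i).dist_add_dist_le (x := walk ζ (ℓ' i + m) • o)
        (y := (g * walk ξ (ℓ j + n)) • o) (R := Q + D) (by
          rw [abs_le]
          constructor <;> linarith) (by
          exact le_trans (by linarith) (neg_le_abs _))
      rw [← dist_smul g (g⁻¹ • o), smul_inv_smul, ← dist_smul g (walk ξ (ℓ j + n) • o) (g⁻¹ • o),
        smul_inv_smul, smul_smul] at h6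
      rw [smul_smul]
      rw [dist_comm o (g • o)] at h6
      linarith
    obtain ⟨m', hm'⟩ := dist_walk_le_of_mem_startSet hζ m
    obtain ⟨n', hn'⟩ := dist_walk_le_of_mem_startSet hξ n
    have h1 := key m' n'
    have h2 := dist_triangle (walk ζ m • o) (walk ζ (ℓ' i + m') • o) o
    have h3 := dist_triangle (walk ξ n • o) (walk ξ (ℓ j + n') • o) o
    have h4 := dist_triangle4 (walk ζ (ℓ' i + m') • o) (walk ζ m • o) (g • walk ξ n • o)
      (g • walk ξ (ℓ j + n') • o)
    rw [dist_smul, dist_comm (walk ζ (ℓ' i + m') • o) (walk ζ m • o)] at h4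
    have h5 := hLM j
    have h6 := hLM' i
    have h7 := le_abs_self M
    linarith

end AlignedWalks

/-! ### Mean growth of subadditive processes -/

section Subadditive

variable {Ω : Type*} {T : Ω → Ω} {Y : ℕ → Ω → ℝ≥0∞}

theorem subadditive_le_sum (h0 : ∀ ω, Y 0 ω = 0)
    (hsub : ∀ m n ω, Y (m + n) ω ≤ Y m ω + Y n (T^[m] ω)) (n : ℕ) (ω : Ω) :
    Y n ω ≤ ∑ k ∈ Finset.range n, Y 1 (T^[k] ω) := by
  induction n with
  | zero => simp [h0]
  | succ n ih =>
    rw [Finset.sum_range_succ]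
    exact (hsub n 1 ω).trans (by gcongr)

/-- Along an orbit, a subadditive process is controlled by greedily splitting time into blocks on
which it grows at rate at most `r`, and blocks of length one. -/
theorem subadditive_le_of_blocks (h0 : ∀ ω, Y 0 ω = 0)
    (hsub : ∀ m n ω, Y (m + n) ω ≤ Y m ω + Y n (T^[m] ω)) {r : ℝ≥0∞} {N : ℕ} {B : Set Ω}
    (hB : ∀ ω ∈ B, ∃ l, 1 ≤ l ∧ l ≤ N ∧ Y l ω ≤ r * l) (n : ℕ) :
    ∀ ω, Y n ω ≤ r * n + ∑ k ∈ Finset.range n, Bᶜ.indicator (Y 1) (T^[k] ω) +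
      ∑ k ∈ Finset.Ico (n - N) n, Y 1 (T^[k] ω) := by
  induction n using Nat.strong_induction_on with
  | _ n ih =>
    intro ω
    by_cases hn : n ≤ N
    · rw [Nat.sub_eq_zero_of_le hn, ← Finset.range_eq_Ico]
      exact (subadditive_le_sum h0 hsub n ω).trans le_add_self
    push Not at hn
    -- Peels off a first block of length l and applies the induction hypothesis to the shifted
    -- orbit; the sum over the last N times absorbs the remainder once at most N steps are left.
    have step : ∀ l, 1 ≤ l → l ≤ n → ∀ c : ℝ≥0∞,
        Y l ω ≤ c → c + (r * (n - l : ℕ) + ∑ k ∈ Finset.Ico l n, Bᶜ.indicator (Y 1) (T^[k] ω) +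
          ∑ k ∈ Finset.Ico (n - N) n, Y 1 (T^[k] ω)) ≥ Y n ω := by
      intro l hl hln c hc
      have h1 := hsub l (n - l) ω
      rw [Nat.add_sub_cancel' hln] at h1
      have h2 := ih (n - l) (by omega) (T^[l] ω)
      refine h1.trans (add_le_add hc (h2.trans ?_))
      simp only [← Function.iterate_add_apply]
      gcongr ?_ + ?_ + ?_
      · exact le_rfl
      · rw [Finset.range_eq_Ico,
          Finset.sum_Ico_add' (fun k => Bᶜ.indicator (Y 1) (T^[k] ω)) 0 (n - l) l, zero_add,
          Nat.sub_add_cancel hln]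
      · rw [Finset.sum_Ico_add' (fun k => Y 1 (T^[k] ω)) (n - l - N) (n - l) l,
          Nat.sub_add_cancel hln]
        exact Finset.sum_le_sum_of_subset (Finset.Ico_subset_Ico (by omega) le_rfl)
    by_cases hω : ω ∈ B
    · obtain ⟨l, hl1, hlN, hl⟩ := hB ω hω
      refine (step l hl1 (by omega) _ hl).le.trans ?_
      rw [← add_assoc, ← add_assoc, ← mul_add, ← Nat.cast_add, Nat.add_sub_cancel' (by omega)]
      gcongr
      rw [Finset.range_eq_Ico]
      exact Finset.Ico_subset_Ico (Nat.zero_le _) le_rfl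
    · refine (step 1 le_rfl (by omega) _ le_rfl).le.trans ?_
      rw [Finset.range_eq_Ico, Finset.sum_eq_sum_Ico_succ_bot (show 0 < n by omega)]
      simp only [Function.iterate_zero, id_eq, zero_add, Set.indicator_of_mem
        (show ω ∈ Bᶜ from hω)]
      have : r * ((n - 1 : ℕ) : ℝ≥0∞) ≤ r * n := by
        gcongr
        exact Nat.sub_le _ _
      calc _ = r * ((n - 1 : ℕ) : ℝ≥0∞) +
            (Y 1 ω + ∑ k ∈ Finset.Ico 1 n, Bᶜ.indicator (Y 1) (T^[k] ω)) +
              ∑ k ∈ Finset.Ico (n - N) n, Y 1 (T^[k] ω) := by ring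
        _ ≤ _ := by gcongr

/-- If an integrable subadditive process over a measure preserving transformation almost surely
reaches growth rate `r`, its mean growth rate is at most `r`. -/
theorem exists_lintegral_le_of_subadditive [MeasurableSpace Ω] {P : Measure Ω}
    [IsProbabilityMeasure P] (hT : MeasurePreserving T P P) (hY : ∀ n, Measurable (Y n)) (h0 : ∀ ω, Y 0 ω = 0)
    (hsub : ∀ m n ω, Y (m + n) ω ≤ Y m ω + Y n (T^[m] ω)) (hint : ∫⁻ ω, Y 1 ω ∂P ≠ ∞)
    {r : ℝ≥0∞} (h : ∀ᵐ ω ∂P, ∃ l ≥ 1, Y l ω ≤ r * l) {ε : ℝ≥0∞} (hε : ε ≠ 0) :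
    ∃ n ≥ 1, ∫⁻ ω, Y n ω ∂P ≤ (r + ε) * (n : ℕ) := by
  -- The minimum with 1 keeps η finite even if ε = ∞. One η pays for orbit points outside `B N`, the
  -- other for the last N times.
  set η := min ε 1 / 2 with hη
  have hη0 : η ≠ 0 := by simp [hη, hε]
  have hηtop : η ≠ ∞ := (ENNReal.div_lt_top ((min_le_right _ _).trans_lt ENNReal.one_lt_top).ne
    (by simp)).ne
  have hηε : η + η ≤ ε := by rw [hη, ENNReal.add_halves]; exact min_le_left _ _
  set B : ℕ → Set Ω := fun N => {ω | ∃ l, 1 ≤ l ∧ l ≤ N ∧ Y l ω ≤ r * l} with hB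
  have hBmeas : ∀ N, MeasurableSet (B N) := fun N => by
    have : B N = ⋃ l, ⋃ _ : 1 ≤ l ∧ l ≤ N, {ω | Y l ω ≤ r * l} := by
      ext ω
      simp [hB, and_assoc]
    rw [this]
    exact MeasurableSet.iUnion fun l => MeasurableSet.iUnion fun _ =>
      measurableSet_le (hY l) measurable_const
  have hanti : Antitone fun N => (B N)ᶜ := fun M N hMN =>
    Set.compl_subset_compl.2 fun ω ⟨l, h1, h2, h3⟩ => ⟨l, h1, h2.trans hMN, h3⟩
  have hzero : P (⋂ N, (B N)ᶜ) = 0 := by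
    refine measure_mono_null (fun ω hω => ?_) (ae_iff.1 h)
    rintro ⟨l, hl, hl'⟩
    exact Set.mem_iInter.1 hω l ⟨l, hl, le_rfl, hl'⟩
  have hlim : Tendsto (fun N => ∫⁻ ω in (B N)ᶜ, Y 1 ω ∂P) atTop (𝓝 0) := by
    refine tendsto_setLIntegral_zero hint ?_
    rw [← hzero]
    exact tendsto_measure_iInter_atTop (fun N => (hBmeas N).compl.nullMeasurableSet) hanti
      ⟨0, measure_ne_top _ _⟩
  obtain ⟨N, hN⟩ := (hlim.eventually (ge_mem_nhds (pos_iff_ne_zero.2 hη0))).exists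
  obtain ⟨n, hn⟩ := ENNReal.exists_nat_gt (r := N * (∫⁻ ω, Y 1 ω ∂P) / η)
    (ENNReal.div_lt_top (ENNReal.mul_ne_top (by simp) hint) hη0).ne
  have hn' : N * (∫⁻ ω, Y 1 ω ∂P) ≤ η * (n + 1 : ℕ) := by
    rw [ENNReal.div_lt_iff (Or.inl hη0) (Or.inl hηtop)] at hn
    refine hn.le.trans ?_
    rw [mul_comm]
    gcongr
    omega
  refine ⟨n + 1, by omega, ?_⟩
  have hφ : Measurable ((B N)ᶜ.indicator (Y 1)) := (hY 1).indicator (hBmeas N).compl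
  have iY : ∀ k, Measurable fun ω => Y 1 (T^[k] ω) := fun k => (hY 1).comp (hT.iterate k).measurable
  have iφ : ∀ k, Measurable fun ω => (B N)ᶜ.indicator (Y 1) (T^[k] ω) := fun k =>
    hφ.comp (hT.iterate k).measurable
  calc ∫⁻ ω, Y (n + 1) ω ∂P
      ≤ ∫⁻ ω, (r * (n + 1 : ℕ) + ∑ k ∈ Finset.range (n + 1), (B N)ᶜ.indicator (Y 1) (T^[k] ω) +
        ∑ k ∈ Finset.Ico (n + 1 - N) (n + 1), Y 1 (T^[k] ω)) ∂P :=
        lintegral_mono fun ω => subadditive_le_of_blocks h0 hsub (fun ω hω => hω) (n + 1) ω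
    _ = r * (n + 1 : ℕ) + ∑ k ∈ Finset.range (n + 1), ∫⁻ ω, (B N)ᶜ.indicator (Y 1) ω ∂P +
        ∑ k ∈ Finset.Ico (n + 1 - N) (n + 1), ∫⁻ ω, Y 1 ω ∂P := by
        rw [lintegral_add_right _ (Finset.measurable_fun_sum _ fun k _ => iY k),
          lintegral_add_right _ (Finset.measurable_fun_sum _ fun k _ => iφ k),
          lintegral_finsetSum _ fun k _ => iY k, lintegral_finsetSum _ fun k _ => iφ k]
        congr 1
        · congr 1
          · simp
          · exact Finset.sum_congr rfl fun k _ => (hT.iterate k).lintegral_comp hφ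
        · exact Finset.sum_congr rfl fun k _ => (hT.iterate k).lintegral_comp (hY 1)
    _ ≤ r * (n + 1 : ℕ) + (n + 1 : ℕ) * η + N * ∫⁻ ω, Y 1 ω ∂P := by
        rw [Finset.sum_const, Finset.sum_const, Finset.card_range, Nat.card_Ico, nsmul_eq_mul,
          nsmul_eq_mul, lintegral_indicator (hBmeas N).compl]
        gcongr
        omega
    _ ≤ r * (n + 1 : ℕ) + (n + 1 : ℕ) * η + η * (n + 1 : ℕ) := by gcongr
    _ = (r + (η + η)) * (n + 1 : ℕ) := by ring
    _ ≤ _ := by gcongr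

end Subadditive

/-! ### Two-sided sample paths and the shift -/

section SamplePath

variable {G : Type*} [Group G]

theorem samplePath_natCast (ω : ℤ → G) (n : ℕ) :
    samplePath ω n = walk (fun i => ω ((i : ℤ) + 1)) n := by
  change samplePath ω (Int.ofNat n) = _
  -- The cast of the index list appears as a monadic bind; it is turned into a map and composed with
  -- the steps.
  rw [samplePath, walk, bind_pure_comp, List.map_eq_map, List.map_map]
  rfl

theorem samplePath_neg (ω : ℤ → G) (n : ℕ) :
    samplePath ω (-(n : ℤ)) = walk (fun i => (ω (-(i : ℤ)))⁻¹) n := by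
  cases n with
  | zero => exact samplePath_natCast ω 0
  | succ n =>
    change samplePath ω (Int.negSucc n) = _
    rw [samplePath, walk, bind_pure_comp, List.map_eq_map, List.map_map]
    rfl

@[simp] theorem samplePath_zero (ω : ℤ → G) : samplePath ω 0 = 1 := samplePath_natCast ω 0

theorem samplePath_succ (ω : ℤ → G) (n : ℤ) :
    samplePath ω (n + 1) = samplePath ω n * ω (n + 1) := by
  rcases n with n | n
  · exact (samplePath_natCast ω (n + 1)).trans
      ((walk_succ _ n).trans (by rw [← samplePath_natCast]; rfl))
  · have h1 : Int.negSucc n + 1 = -(n : ℤ) := by omega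
    have h2 : Int.negSucc n = -((n + 1 : ℕ) : ℤ) := rfl
    rw [h1, h2, samplePath_neg, samplePath_neg, walk_succ, inv_mul_cancel_right]

/-- The shift on the step space. -/
def shift (a : ℤ) (ω : ℤ → G) : ℤ → G := fun i => ω (i + a)

theorem samplePath_add (ω : ℤ → G) (a n : ℤ) :
    samplePath ω (a + n) = samplePath ω a * samplePath (shift a ω) n := by
  induction n with
  | zero => simp
  | succ n ih =>
    rw [← add_assoc, samplePath_succ, ih, samplePath_succ, mul_assoc]
    congr 3
    ring
  | pred n ih =>
    have h1 := samplePath_succ ω (a + (-n - 1))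
    have h2 := samplePath_succ (shift a ω) (-n - 1)
    rw [show a + (-(n : ℤ) - 1) + 1 = a + -n by ring] at h1
    rw [show -(n : ℤ) - 1 + 1 = -n by ring] at h2
    rw [ih, h2, ← mul_assoc] at h1
    have h3 : shift a ω (-n) = ω (a + -n) := by rw [shift, add_comm]
    rw [h3] at h1
    exact (mul_right_cancel h1).symm

omit [Group G] in
theorem shift_iterate (a : ℤ) (n : ℕ) (ω : ℤ → G) : (shift a)^[n] ω = shift (a * n) ω := by
  induction n with
  | zero => funext i; simp [shift]
  | succ n ih =>
    rw [Function.iterate_succ_apply', ih]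
    funext i
    simp only [shift]
    congr 1
    push_cast
    ring

section Measure

variable [MeasurableSpace G] (μ : Measure G) [IsProbabilityMeasure μ]

instance : IsProbabilityMeasure (stepMeasure μ) := by
  rw [stepMeasure]
  infer_instance

omit [Group G] in
theorem measurePreserving_shift (a : ℤ) :
    MeasurePreserving (shift a) (stepMeasure μ) (stepMeasure μ) :=
  measurePreserving_reindex μ (add_left_injective a)

omit [Group G] in
theorem measurePreserving_forward (k : ℤ) :
    MeasurePreserving (fun (ω : ℤ → G) (i : ℕ) => ω (k + i + 1)) (stepMeasure μ)
      (Measure.infinitePi fun _ : ℕ => μ) :=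
  measurePreserving_reindex μ (f := fun i : ℕ => k + i + 1) fun i j h => by simpa using h

theorem measurePreserving_backward [DiscreteMeasurableSpace G] :
    MeasurePreserving (fun (ω : ℤ → G) (i : ℕ) => (ω (-(i : ℤ)))⁻¹) (stepMeasure μ)
      (Measure.infinitePi fun _ : ℕ => μ.map (·⁻¹)) := by
  have h1 : MeasurePreserving (fun (ω : ℤ → G) (i : ℕ) => ω (-(i : ℤ))) (stepMeasure μ)
      (Measure.infinitePi fun _ : ℕ => μ) :=
    measurePreserving_reindex μ (f := fun i : ℕ => -(i : ℤ)) fun i j h => by simpa using h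
  have h2 : MeasurePreserving (fun (ξ : ℕ → G) (i : ℕ) => (ξ i)⁻¹)
      (Measure.infinitePi fun _ : ℕ => μ) (Measure.infinitePi fun _ : ℕ => μ.map (·⁻¹)) :=
    ⟨measurable_pi_lambda _ fun i => Measurable.of_discrete.comp (measurable_pi_apply i),
      Measure.infinitePi_map_pi _ fun _ => Measurable.of_discrete⟩
  exact h2.comp h1

theorem measurable_samplePath [Countable G] [DiscreteMeasurableSpace G] (n : ℤ) :
    Measurable fun ω : ℤ → G => samplePath ω n := by
  obtain ⟨n, rfl | rfl⟩ := n.eq_nat_or_neg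
  · simp only [samplePath_natCast]
    exact (measurable_walk n).comp (measurable_pi_lambda _ fun i => measurable_pi_apply _)
  · simp only [samplePath_neg]
    exact (measurable_walk n).comp (measurable_pi_lambda _ fun i =>
      Measurable.of_discrete.comp (measurable_pi_apply _))

end Measure

end SamplePath

/-! ### Progress made over aligned blocks -/

section AlignedSet

variable {X : Type*} [MetricSpace X] {G : Type*} [Group G] [MulAction G X] {o : X} {C : ℝ}

/-- The event that the sample path is almost geodesic around the time interval `[0, k]`. -/
def alignedSet (o : X) (C : ℝ) (k : ℕ) : Set (ℤ → G) :=
  {ω | ∀ m n : ℕ, dist (samplePath ω (-m) • o) o + dist (samplePath ω k • o) o +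
    dist (samplePath ω k • o) (samplePath ω (k + n) • o) ≤
      dist (samplePath ω (-m) • o) (samplePath ω (k + n) • o) + C}

/-- The truncated displacement of `g`, reduced by the alignment error `C`. -/
noncomputable def truncDist (o : X) (C : ℝ) (N : ℕ) (g : G) : ℝ≥0∞ :=
  min (ENNReal.ofReal (dist (g • o) o - C)) N

/-- The truncated progress made by the sample path during `[0, k]` when it is aligned. -/
noncomputable def progress (o : X) (C : ℝ) (k N : ℕ) : (ℤ → G) → ℝ≥0∞ :=
  (alignedSet o C k).indicator fun ω => truncDist o C N (samplePath ω k)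

theorem progress_le (o : X) (C : ℝ) (k N : ℕ) (ω : ℤ → G) : progress o C k N ω ≤ N := by
  refine (Set.indicator_le_self' (fun _ _ => zero_le) _).trans ?_
  exact min_le_right _ _

theorem sum_progress_le [IsIsometricSMul G X] (o : X) (C : ℝ) (k N : ℕ) (ω : ℤ → G) (J : ℕ) :
    ∀ n : ℕ, k * J ≤ n → ∑ j ∈ Finset.range J, progress o C k N (shift (k * j) ω) ≤
      edist o (samplePath ω n • o) := by
  induction J with
  | zero => simp
  | succ J ih =>
    intro n hn
    rw [mul_add, mul_one] at hn
    rw [Finset.sum_range_succ]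
    have hkJ : k * J ≤ n := by omega
    by_cases hω : shift (k * J) ω ∈ alignedSet o C k
    · rw [progress, Set.indicator_of_mem hω]
      set W := samplePath ω ((k * J : ℕ) : ℤ) with hW
      rcases le_or_gt (dist (samplePath (shift (k * J) ω) k • o) o - C) 0 with hneg | hpos
      · have : truncDist o C N (samplePath (shift (k * J) ω) k) = 0 := by
          rw [truncDist, ENNReal.ofReal_of_nonpos hneg]
          simp
        rw [this, add_zero]
        exact ih n hkJ
      -- Seen from time kJ, the point kJ steps in the past is the origin of the walk, and the chosen
      -- future point is the position at time n.
      · have h1 := hω (k * J) (n - (k * J + k))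
        have e1 : samplePath (shift (k * J) ω) (-((k * J : ℕ) : ℤ)) = W⁻¹ := by
          have := samplePath_add ω ((k * J : ℕ) : ℤ) (-((k * J : ℕ) : ℤ))
          rw [add_neg_cancel, samplePath_zero] at this
          push_cast at this hW ⊢
          rw [← hW] at this
          exact (inv_eq_of_mul_eq_one_right this.symm).symm
        have e2 : samplePath (shift (k * J) ω) (k + ((n - (k * J + k) : ℕ) : ℤ)) =
            W⁻¹ * samplePath ω n := by
          have := samplePath_add ω ((k * J : ℕ) : ℤ) (k + ((n - (k * J + k) : ℕ) : ℤ))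
          rw [show ((k * J : ℕ) : ℤ) + (k + ((n - (k * J + k) : ℕ) : ℤ)) = n by omega] at this
          rw [this, ← hW, inv_mul_cancel_left]
          push_cast
          rfl
        rw [e1, e2, mul_smul, dist_smul, ← dist_smul W (W⁻¹ • o), smul_inv_smul] at h1
        have h2 : dist o (W • o) + (dist (samplePath (shift (k * J) ω) k • o) o - C) ≤
            dist o (samplePath ω n • o) := by
          linarith [dist_nonneg (x := samplePath (shift (k * J) ω) k • o)
            (y := W⁻¹ • samplePath ω n • o)]
        calc _ ≤ edist o (W • o) +
              ENNReal.ofReal (dist (samplePath (shift (k * J) ω) k • o) o - C) :=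
              add_le_add (ih (k * J) le_rfl) (min_le_left _ _)
          _ = ENNReal.ofReal (dist o (W • o) +
              (dist (samplePath (shift (k * J) ω) k • o) o - C)) := by
              rw [edist_dist, ENNReal.ofReal_add dist_nonneg hpos.le]
          _ ≤ _ := by
              rw [edist_dist]
              exact ENNReal.ofReal_le_ofReal h2
    · rw [progress, Set.indicator_of_notMem hω, add_zero]
      exact ih n hkJ

variable [MeasurableSpace G] [Countable G] [DiscreteMeasurableSpace G]

theorem measurableSet_alignedSet (o : X) (C : ℝ) (k : ℕ) :
    MeasurableSet (alignedSet o C k : Set (ℤ → G)) := by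
  have : (alignedSet o C k : Set (ℤ → G)) = ⋂ m : ℕ, ⋂ n : ℕ,
      (fun ω : ℤ → G => (samplePath ω (-m), samplePath ω k, samplePath ω (k + n))) ⁻¹'
        {p : G × G × G | dist (p.1 • o) o + dist (p.2.1 • o) o + dist (p.2.1 • o) (p.2.2 • o) ≤
          dist (p.1 • o) (p.2.2 • o) + C} := by
    ext ω
    simp [alignedSet]
  rw [this]
  exact MeasurableSet.iInter fun m => MeasurableSet.iInter fun n =>
    ((measurable_samplePath _).prodMk ((measurable_samplePath _).prodMk (measurable_samplePath _)))
      MeasurableSet.of_discrete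

theorem measurable_progress (o : X) (C : ℝ) (k N : ℕ) :
    Measurable (progress o C k N : (ℤ → G) → ℝ≥0∞) :=
  ((Measurable.of_discrete (f := truncDist (G := G) o C N)).comp
    (measurable_samplePath k)).indicator (measurableSet_alignedSet o C k)

variable (μ : Measure G) [IsProbabilityMeasure μ]

/-- If forward and backward walks are aligned with probability bounded below, uniformly in the
jump between them, then the mean progress is comparable to the mean displacement. -/
theorem mul_lintegral_le_lintegral_progress {δ : ℝ≥0∞}
    (h : ∀ g : G, ∃ F B : Set (ℕ → G), MeasurableSet F ∧ MeasurableSet B ∧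
      δ ≤ Measure.infinitePi (fun _ : ℕ => μ) F ∧
      δ ≤ Measure.infinitePi (fun _ : ℕ => μ.map (·⁻¹)) B ∧ ∀ ξ ∈ F, ∀ ζ ∈ B, ∀ m n,
        dist (walk ζ m • o) o + dist (g • o) o + dist (walk ξ n • o) o ≤
          dist (walk ζ m • o) (g • walk ξ n • o) + C) [IsIsometricSMul G X] (k N : ℕ) :
    δ * δ * ∫⁻ ω, truncDist o C N (samplePath ω k) ∂(stepMeasure μ) ≤
      ∫⁻ ω, progress o C k N ω ∂(stepMeasure μ) := by
  choose F B hF hB hδF hδB hFB using h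
  set P := stepMeasure μ with hP
  set M : G → Set (ℤ → G) := fun g => {ω | samplePath ω k = g} with hM
  set F' : G → Set (ℤ → G) := fun g => (fun ω i => ω (k + (i : ℕ) + 1)) ⁻¹' F g with hF'
  set B' : G → Set (ℤ → G) := fun g => (fun ω i => (ω (-((i : ℕ) : ℤ)))⁻¹) ⁻¹' B g with hB'
  have hMm : ∀ g, MeasurableSet (M g) := fun g =>
    measurable_samplePath k (MeasurableSet.of_discrete (s := {g}))
  have hFm : ∀ g, MeasurableSet (F' g) := fun g => (measurePreserving_forward μ k).measurable (hF g)
  have hBm : ∀ g, MeasurableSet (B' g) := fun g => (measurePreserving_backward μ).measurable (hB g)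
  -- The three events use the steps with index ≤ 0, in [1, k], and ≥ k + 1, hence are independent.
  have hind : ∀ g, δ * δ * P (M g) ≤ P (B' g ∩ (M g ∩ F' g)) := fun g => by
    have dM : DependsOn (· ∈ M g) {i : ℤ | 1 ≤ i ∧ i ≤ k} := fun x y hxy => by
      have : samplePath x k = samplePath y k := by
        rw [samplePath_natCast, samplePath_natCast]
        exact walk_congr fun i hi => hxy _ ⟨by omega, by omega⟩
      simp only [hM, Set.mem_ofPred_eq, this]
    have dF : DependsOn (· ∈ F' g) {i : ℤ | k + 1 ≤ i} := fun x y hxy => by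
      have : (fun i : ℕ => x (k + i + 1)) = fun i : ℕ => y (k + i + 1) :=
        funext fun i => hxy _ (show (k : ℤ) + 1 ≤ k + i + 1 by omega)
      simp only [hF', Set.mem_preimage, this]
    have dB : DependsOn (· ∈ B' g) {i : ℤ | i ≤ 0} := fun x y hxy => by
      have : (fun i : ℕ => (x (-(i : ℤ)))⁻¹) = fun i : ℕ => (y (-(i : ℤ)))⁻¹ :=
        funext fun i => by rw [hxy _ (show -(i : ℤ) ≤ 0 by omega)]
      simp only [hB', Set.mem_preimage, this]
    have dMF : DependsOn (· ∈ M g ∩ F' g) {i : ℤ | 1 ≤ i} := fun x y hxy => by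
      have h1 := dM (x := x) (y := y) fun i hi => hxy i hi.1
      have h2 := dF (x := x) (y := y) fun i hi => hxy i
        (show 1 ≤ i by have : (k : ℤ) + 1 ≤ i := hi; omega)
      simp only [Set.mem_inter_iff]
      simp only at h1 h2
      rw [h1, h2]
    have e1 : P (M g ∩ F' g) = P (M g) * P (F' g) :=
      infinitePi_inter_of_dependsOn μ (Set.disjoint_left.2 fun (i : ℤ) (h1 : 1 ≤ i ∧ i ≤ (k : ℤ))
        (h2 : (k : ℤ) + 1 ≤ i) => by omega) (hMm g) (hFm g) dM dF
    have e2 : P (B' g ∩ (M g ∩ F' g)) = P (B' g) * P (M g ∩ F' g) :=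
      infinitePi_inter_of_dependsOn μ (Set.disjoint_left.2 fun (i : ℤ) (h1 : i ≤ 0)
        (h2 : 1 ≤ i) => by omega) (hBm g) ((hMm g).inter (hFm g)) dB dMF
    have e3 : P (F' g) = Measure.infinitePi (fun _ : ℕ => μ) (F g) :=
      (measurePreserving_forward μ k).measure_preimage (hF g).nullMeasurableSet
    have e4 : P (B' g) = Measure.infinitePi (fun _ : ℕ => μ.map (·⁻¹)) (B g) :=
      (measurePreserving_backward μ).measure_preimage (hB g).nullMeasurableSet
    rw [e2, e1, e3, e4]
    calc δ * δ * P (M g) = δ * (P (M g) * δ) := by ring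
      _ ≤ _ := by
        gcongr
        · exact hδB g
        · exact hδF g
  have hle : ∀ ω, ∑' g, (B' g ∩ (M g ∩ F' g)).indicator (fun _ => truncDist o C N g) ω ≤
      progress o C k N ω := fun ω => by
    rw [tsum_eq_single (samplePath ω k) fun g hg => Set.indicator_of_notMem
      (fun h => hg h.2.1.symm) _]
    by_cases hω : ω ∈ B' (samplePath ω k) ∩ (M (samplePath ω k) ∩ F' (samplePath ω k))
    · have hal : ω ∈ alignedSet o C k := fun m n => by
        have := hFB _ _ hω.2.2 _ hω.1 m n
        have e : samplePath ω (k + n) = samplePath ω k * walk (fun i : ℕ => ω (k + i + 1)) n := by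
          rw [samplePath_add, samplePath_natCast (shift _ _)]
          congr 3
          funext i
          rw [shift]
          congr 1
          ring
        rw [samplePath_neg, e, mul_smul, dist_comm (samplePath ω k • o) (samplePath ω k • _),
          dist_smul]
        exact this
      rw [Set.indicator_of_mem hω, progress, Set.indicator_of_mem hal]
    · rw [Set.indicator_of_notMem hω]
      exact zero_le
  calc δ * δ * ∫⁻ ω, truncDist o C N (samplePath ω k) ∂P
      = δ * δ * ∑' g, truncDist o C N g * P (M g) := by
        have h1 : ∫⁻ ω, truncDist o C N (samplePath ω k) ∂P =
            ∫⁻ g, truncDist o C N g ∂(P.map fun ω => samplePath ω k) :=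
          (lintegral_map Measurable.of_discrete (measurable_samplePath k)).symm
        rw [h1, lintegral_countable']
        congr 1
        refine tsum_congr fun g => ?_
        rw [Measure.map_apply (measurable_samplePath k) MeasurableSet.of_discrete]
        rfl
    _ ≤ ∑' g, truncDist o C N g * P (B' g ∩ (M g ∩ F' g)) := by
        rw [← ENNReal.tsum_mul_left]
        refine ENNReal.tsum_le_tsum fun g => ?_
        calc δ * δ * (truncDist o C N g * P (M g)) =
            truncDist o C N g * (δ * δ * P (M g)) := by ring
          _ ≤ _ := by gcongr; exact hind g
    _ = ∑' g, ∫⁻ ω, (B' g ∩ (M g ∩ F' g)).indicator (fun _ => truncDist o C N g) ω ∂P := by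
        refine tsum_congr fun g => ?_
        rw [lintegral_indicator_const ((hBm g).inter ((hMm g).inter (hFm g)))]
    _ = ∫⁻ ω, ∑' g, (B' g ∩ (M g ∩ F' g)).indicator (fun _ => truncDist o C N g) ω ∂P :=
        (lintegral_tsum fun g => (measurable_const.indicator
          ((hBm g).inter ((hMm g).inter (hFm g)))).aemeasurable).symm
    _ ≤ _ := lintegral_mono hle

end AlignedSet

/-! ### Displacement: constant liminf and block averages -/

section Displacement

variable {X : Type*} [MetricSpace X] {G : Type*} [Group G] [MulAction G X] [IsIsometricSMul G X]

theorem dist_samplePath_add_le (o : X) (ω : ℤ → G) (a b : ℤ) :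
    dist o (samplePath ω (a + b) • o) ≤
      dist o (samplePath ω a • o) + dist o (samplePath (shift a ω) b • o) := by
  rw [samplePath_add, mul_smul]
  refine (dist_triangle _ (samplePath ω a • o) _).trans ?_
  rw [dist_smul]

theorem edist_samplePath_add_le (o : X) (ω : ℤ → G) (a b : ℤ) :
    edist o (samplePath ω (a + b) • o) ≤
      edist o (samplePath ω a • o) + edist o (samplePath (shift a ω) b • o) := by
  rw [edist_dist, edist_dist, edist_dist, ← ENNReal.ofReal_add dist_nonneg dist_nonneg]
  exact ENNReal.ofReal_le_ofReal (dist_samplePath_add_le o ω a b)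

variable [MeasurableSpace G] [Countable G] [DiscreteMeasurableSpace G]
  (μ : Measure G) [IsProbabilityMeasure μ] (o : X)

theorem exists_liminf_walk_eq : ∃ z : ℝ≥0∞, ∀ᵐ ξ ∂(Measure.infinitePi fun _ : ℕ => μ),
    liminf (fun n : ℕ => edist o (walk ξ n • o) / (n : ℝ≥0∞)) atTop = z := by
  set L : (ℕ → G) → ℝ≥0∞ :=
    fun ξ => liminf (fun n : ℕ => edist o (walk ξ n • o) / (n : ℝ≥0∞)) atTop with hL
  have hLm : Measurable L := Measurable.liminf fun n =>
    (Measurable.of_discrete (f := fun g : G => edist o (g • o) / (n : ℝ≥0∞))).comp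
      (measurable_walk n)
  -- Changing the first K steps alters the displacement at later times by at most the constant `c`,
  -- which is negligible after dividing by n.
  have hle : ∀ (K : ℕ) (ξ ζ : ℕ → G), (∀ i, K ≤ i → ξ i = ζ i) → L ξ ≤ L ζ := by
    intro K ξ ζ h
    set c := edist ((walk ξ K)⁻¹ • o) ((walk ζ K)⁻¹ • o) with hc
    have hlim : Tendsto (fun n : ℕ => c / (n : ℝ≥0∞)) atTop (𝓝 0) :=
      ENNReal.Tendsto.const_div ENNReal.tendsto_nat_nhds_top (Or.inr (edist_ne_top _ _)) |>.trans
        (by simp)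
    rw [hL]
    simp only
    rw [← ENNReal.liminf_add_of_right_tendsto_zero hlim
      (fun n : ℕ => edist o (walk ζ n • o) / (n : ℝ≥0∞))]
    refine liminf_le_liminf ?_
    filter_upwards [eventually_ge_atTop K] with n hn
    rw [Pi.add_apply, ← ENNReal.add_div]
    gcongr
    obtain ⟨m, rfl⟩ := Nat.exists_eq_add_of_le hn
    have hv : (fun i => ξ (K + i)) = fun i => ζ (K + i) := funext fun i => h _ (by omega)
    rw [walk_add, walk_add, hv, mul_smul, mul_smul]
    set v := walk (fun i => ζ (K + i)) m • o
    rw [← edist_smul_left (walk ξ K)⁻¹ o, inv_smul_smul, ← edist_smul_left (walk ζ K)⁻¹ o, inv_smul_smul,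
      add_comm]
    exact edist_triangle _ _ _
  obtain ⟨z, hz⟩ := exists_eventuallyEq_const_of_forall_separating
    (l := ae (Measure.infinitePi fun _ : ℕ => μ)) (f := L) MeasurableSet fun U hU => by
      have hdep : ∀ K, DependsOn (· ∈ L ⁻¹' U) {i | K ≤ i} := fun K ξ ζ h => by
        have : L ξ = L ζ := le_antisymm (hle K ξ ζ h) (hle K ζ ξ fun i hi => (h i hi).symm)
        simp only [Set.mem_preimage, this]
      rcases infinitePi_eq_zero_or_one μ (hLm hU) hdep with h | h
      · right
        exact measure_eq_zero_iff_ae_notMem.1 h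
      · left
        exact (prob_compl_eq_zero_iff (hLm hU)).2 h
  exact ⟨z, hz⟩

theorem exists_liminf_eq : ∃ z : ℝ≥0∞, ∀ᵐ ω ∂(stepMeasure μ),
    liminf (fun n : ℕ => edist o (samplePath ω (n : ℤ) • o) / (n : ℝ≥0∞)) atTop = z := by
  obtain ⟨z, hz⟩ := exists_liminf_walk_eq μ o
  refine ⟨z, ?_⟩
  filter_upwards [(measurePreserving_forward μ 0).quasiMeasurePreserving.ae hz] with ω hω
  simpa only [samplePath_natCast, zero_add] using hω

omit [IsIsometricSMul G X] in
theorem measurable_edist_samplePath (n : ℤ) :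
    Measurable fun ω : ℤ → G => edist o (samplePath ω n • o) :=
  (Measurable.of_discrete (f := fun g : G => edist o (g • o))).comp (measurable_samplePath n)

omit [Countable G] [DiscreteMeasurableSpace G] in
theorem map_samplePath_one : (stepMeasure μ).map (fun ω => samplePath ω ((1 : ℕ) : ℤ)) = μ := by
  have : (fun ω : ℤ → G => samplePath ω ((1 : ℕ) : ℤ)) = fun ω => ω 1 := by
    funext ω
    rw [samplePath_natCast]
    simp [walk]
  rw [this]
  exact Measure.infinitePi_map_eval (fun _ : ℤ => μ) 1

omit [IsIsometricSMul G X] in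
theorem lintegral_edist_samplePath_one :
    ∫⁻ ω, edist o (samplePath ω ((1 : ℕ) : ℤ) • o) ∂(stepMeasure μ) = firstMoment o μ := by
  rw [firstMoment]
  conv_rhs => rw [← map_samplePath_one μ]
  rw [lintegral_map Measurable.of_discrete (measurable_samplePath _)]

theorem lintegral_edist_samplePath_lt_top (h : firstMoment o μ < ∞) (n : ℕ) :
    ∫⁻ ω, edist o (samplePath ω (n : ℤ) • o) ∂(stepMeasure μ) < ∞ := by
  induction n with
  | zero => simp
  | succ n ih =>
    refine (lintegral_mono (g := fun ω => edist o (samplePath ω (n : ℤ) • o) +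
      edist o (samplePath (shift n ω) ((1 : ℕ) : ℤ) • o)) fun ω => ?_).trans_lt ?_
    · have := edist_samplePath_add_le o ω n ((1 : ℕ) : ℤ)
      push_cast at this ⊢
      exact this
    · rw [lintegral_add_left (measurable_edist_samplePath o _),
        (measurePreserving_shift μ n).lintegral_comp
          (f := fun ω => edist o (samplePath ω ((1 : ℕ) : ℤ) • o))
          (measurable_edist_samplePath o _),
        lintegral_edist_samplePath_one]
      exact ENNReal.add_lt_top.2 ⟨ih, h⟩

theorem integrable_dist_samplePath (h : firstMoment o μ < ∞) (n : ℕ) :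
    Integrable (fun ω => dist o (samplePath ω (n : ℤ) • o)) (stepMeasure μ) := by
  refine ⟨((Measurable.of_discrete (f := fun g : G => dist o (g • o))).comp
    (measurable_samplePath n)).aestronglyMeasurable, ?_⟩
  rw [hasFiniteIntegral_iff_ofReal (ae_of_all _ fun ω => dist_nonneg)]
  simpa only [edist_dist] using lintegral_edist_samplePath_lt_top μ o h n

/-- The strong law of large numbers for the displacements over consecutive time blocks. -/
theorem tendsto_sum_dist_div (h : firstMoment o μ < ∞) (k : ℕ) :
    ∀ᵐ ω ∂(stepMeasure μ), Tendsto (fun n : ℕ => (∑ i ∈ Finset.range n,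
      dist o (samplePath (shift (k * i) ω) (k : ℤ) • o)) / n) atTop
        (𝓝 (∫ ω, dist o (samplePath ω (k : ℤ) • o) ∂(stepMeasure μ))) := by
  have hmeas : Measurable fun ω : ℤ → G => dist o (samplePath ω (k : ℤ) • o) :=
    (Measurable.of_discrete (f := fun g : G => dist o (g • o))).comp (measurable_samplePath k)
  have hmeas' : ∀ i : ℕ, Measurable fun ω : ℤ → G =>
      dist o (samplePath (shift (k * i) ω) (k : ℤ) • o) := fun i =>
    hmeas.comp (measurePreserving_shift μ (k * i)).measurable
  have hshift0 : ∀ ω : ℤ → G, shift ((k : ℤ) * (0 : ℕ)) ω = ω := fun ω => by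
    funext i
    simp [shift]
  have := ProbabilityTheory.strong_law_ae_real (μ := stepMeasure μ)
    (fun (i : ℕ) ω => dist o (samplePath (shift (k * i) ω) (k : ℤ) • o))
    (by simpa only [hshift0] using integrable_dist_samplePath μ o h k)
    (fun i j hij => ?_) (fun i => ?_)
  · simpa only [hshift0] using this
  · refine ProbabilityTheory.indepFun_iff_measure_inter_preimage_eq_mul.2 fun s t hs ht => ?_
    -- Block displacements use the disjoint step windows [ki+1, ki+k], which gives pairwise
    -- independence.
    have hdep : ∀ (i : ℕ) (s : Set ℝ), DependsOn
        (· ∈ (fun ω : ℤ → G => dist o (samplePath (shift (k * i) ω) (k : ℤ) • o)) ⁻¹' s)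
        {l : ℤ | k * i + 1 ≤ l ∧ l ≤ k * i + k} := fun i s x y hxy => by
      have : samplePath (shift (k * i) x) (k : ℤ) = samplePath (shift (k * i) y) (k : ℤ) := by
        rw [samplePath_natCast, samplePath_natCast]
        refine walk_congr fun l hl => hxy _ ⟨?_, ?_⟩ <;> omega
      simp only [Set.mem_preimage, this]
    refine infinitePi_inter_of_dependsOn μ ?_ (hmeas' i hs) (hmeas' j ht) (hdep i s) (hdep j t)
    refine Set.disjoint_left.2 fun l hl hl' => ?_
    obtain ⟨h1, h2⟩ := hl
    obtain ⟨h3, h4⟩ := hl'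
    rcases lt_or_gt_of_ne hij with hlt | hlt
    · have : (k : ℤ) * (i + 1) ≤ k * j := by gcongr; exact_mod_cast hlt
      linarith
    · have : (k : ℤ) * (j + 1) ≤ k * i := by gcongr; exact_mod_cast hlt
      linarith
  · simp only [hshift0]
    refine ⟨(hmeas' i).aemeasurable, hmeas.aemeasurable, ?_⟩
    rw [← (measurePreserving_shift μ (k * i)).map_eq,
      Measure.map_map hmeas (measurePreserving_shift μ (k * i)).measurable,
      (measurePreserving_shift μ (k * i)).map_eq]
    rfl

end Displacement

/-! ### Bounds on the upper and lower growth rates -/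

section LimsupBound

variable {X : Type*} [MetricSpace X] {G : Type*} [Group G] [MulAction G X] [IsIsometricSMul G X]

theorem dist_samplePath_mul_le_sum (o : X) (ω : ℤ → G) (k J : ℕ) :
    dist o (samplePath ω ((k * J : ℕ) : ℤ) • o) ≤
      ∑ j ∈ Finset.range J, dist o (samplePath (shift (k * j) ω) (k : ℤ) • o) := by
  induction J with
  | zero => simp
  | succ J ih =>
    rw [Finset.sum_range_succ]
    have := dist_samplePath_add_le o ω ((k * J : ℕ) : ℤ) k
    rw [show (((k * (J + 1) : ℕ)) : ℤ) = ((k * J : ℕ) : ℤ) + k by push_cast; ring]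
    refine this.trans (add_le_add ih (le_of_eq ?_))
    push_cast
    rfl

theorem dist_samplePath_le_add_sum (o : X) (ω : ℤ → G) {a n : ℕ} (h : a ≤ n) :
    dist o (samplePath ω (n : ℤ) • o) ≤ dist o (samplePath ω (a : ℤ) • o) +
      (∑ i ∈ Finset.range n, dist o (samplePath (shift ((1 : ℕ) * i) ω) ((1 : ℕ) : ℤ) • o) -
        ∑ i ∈ Finset.range a, dist o (samplePath (shift ((1 : ℕ) * i) ω) ((1 : ℕ) : ℤ) • o)) := by
  induction n, h using Nat.le_induction with
  | base => simp
  | succ n _ ih =>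
    rw [Finset.sum_range_succ]
    have := dist_samplePath_add_le o ω (n : ℤ) ((1 : ℕ) : ℤ)
    rw [show ((n + 1 : ℕ) : ℤ) = (n : ℤ) + ((1 : ℕ) : ℤ) by push_cast; ring]
    have h2 : shift ((1 : ℕ) * (n : ℤ)) ω = shift (n : ℤ) ω := by simp
    rw [h2]
    linarith

theorem tendsto_nat_div_div {m : ℕ} (hm : 1 ≤ m) :
    Tendsto (fun n : ℕ => ((n / m : ℕ) : ℝ) / n) atTop (𝓝 (1 / m)) := by
  have h := (tendsto_nat_floor_mul_div_atTop (R := ℝ) (a := 1 / m) (by positivity)).comp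
    tendsto_natCast_atTop_atTop
  refine h.congr fun n => ?_
  simp only [Function.comp_apply]
  rw [one_div_mul_eq_div, Nat.floor_div_eq_div]

/-- The incomplete last block is negligible because A n / n converges and m⌊n/m⌋/n → 1; no bound on
single steps is needed. -/
theorem tendsto_block_average {S A : ℕ → ℝ} {s a : ℝ} (hS : Tendsto (fun n : ℕ => S n / n) atTop (𝓝 s))
    (hA : Tendsto (fun n : ℕ => A n / n) atTop (𝓝 a)) (hS0 : S 0 = 0) (hA0 : A 0 = 0) {m : ℕ}
    (hm : 1 ≤ m) :
    Tendsto (fun n : ℕ => (S (n / m) + (A n - A (m * (n / m)))) / n) atTop (𝓝 (s / m)) := by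
  have hdiv := Nat.tendsto_div_const_atTop (n := m) (by omega)
  have hmul : Tendsto (fun n : ℕ => m * (n / m)) atTop atTop :=
    (tendsto_id.const_mul_atTop' (by omega : 0 < m)).comp hdiv
  have h1 := (hS.comp hdiv).mul (tendsto_nat_div_div hm)
  have h2 := (hA.comp hmul).mul ((tendsto_nat_div_div hm).const_mul (m : ℝ))
  have hm' : (m : ℝ) ≠ 0 := by positivity
  have h3 := h1.add (hA.sub h2)
  rw [mul_one_div_cancel hm', mul_one, sub_self, add_zero, mul_one_div] at h3
  refine h3.congr fun n => ?_
  simp only [Function.comp_apply]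
  rcases Nat.eq_zero_or_pos (n / m) with h0 | h0
  · simp [h0, hS0, hA0]
  · have h4 : ((n / m : ℕ) : ℝ) ≠ 0 := by positivity
    push_cast
    field_simp

variable [MeasurableSpace G] [Countable G] [DiscreteMeasurableSpace G]
  (μ : Measure G) [IsProbabilityMeasure μ] (o : X)

theorem limsup_edist_div_le (h : firstMoment o μ < ∞) {m : ℕ} (hm : 1 ≤ m) :
    ∀ᵐ ω ∂(stepMeasure μ), limsup (fun n : ℕ => edist o (samplePath ω (n : ℤ) • o) / (n : ℝ≥0∞))
      atTop ≤ (∫⁻ ω, edist o (samplePath ω (m : ℤ) • o) ∂(stepMeasure μ)) / m := by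
  filter_upwards [tendsto_sum_dist_div μ o h m, tendsto_sum_dist_div μ o h 1] with ω hω hω'
  have hlim := tendsto_block_average hω hω' (by simp) (by simp) hm
  have hint : (∫⁻ ω, edist o (samplePath ω (m : ℤ) • o) ∂(stepMeasure μ)) / m =
      ENNReal.ofReal ((∫ ω, dist o (samplePath ω (m : ℤ) • o) ∂(stepMeasure μ)) / m) := by
    rw [ENNReal.ofReal_div_of_pos (by positivity), ENNReal.ofReal_natCast,
      ofReal_integral_eq_lintegral_ofReal (integrable_dist_samplePath μ o h m)
        (ae_of_all _ fun ω => dist_nonneg)]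
    simp only [edist_dist]
  rw [hint, ← (ENNReal.tendsto_ofReal hlim).limsup_eq]
  refine limsup_le_limsup ?_
  filter_upwards [eventually_ge_atTop 1] with n hn
  rw [edist_dist, ← ENNReal.ofReal_natCast n, ← ENNReal.ofReal_div_of_pos (by positivity)]
  refine ENNReal.ofReal_le_ofReal ?_
  gcongr
  refine (dist_samplePath_le_add_sum o ω (Nat.mul_div_le n m)).trans ?_
  gcongr
  exact dist_samplePath_mul_le_sum o ω m (n / m)

/-- The almost sure lower growth rate of the displacement bounds its mean growth rate. -/
theorem exists_lintegral_edist_le (h : firstMoment o μ < ∞) {z r ε : ℝ≥0∞}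
    (hz : ∀ᵐ ω ∂(stepMeasure μ),
      liminf (fun n : ℕ => edist o (samplePath ω (n : ℤ) • o) / (n : ℝ≥0∞)) atTop = z)
    (hr : z < r) (hε : ε ≠ 0) :
    ∃ n ≥ 1, ∫⁻ ω, edist o (samplePath ω ((n : ℕ) : ℤ) • o) ∂(stepMeasure μ) ≤
      (r + ε) * (n : ℕ) := by
  refine exists_lintegral_le_of_subadditive (measurePreserving_shift μ 1)
    (Y := fun n ω => edist o (samplePath ω ((n : ℕ) : ℤ) • o))
    (fun n => measurable_edist_samplePath o n) (fun ω => by simp) (fun m n ω => ?_)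
    (lintegral_edist_samplePath_lt_top μ o h 1).ne ?_ hε
  · rw [shift_iterate, one_mul]
    push_cast
    exact edist_samplePath_add_le o ω m n
  · filter_upwards [hz] with ω hω
    have hfreq := frequently_lt_of_liminf_lt (by isBoundedDefault) (hω.trans_lt hr)
    obtain ⟨n, hn, hn1⟩ := (hfreq.and_eventually (eventually_ge_atTop 1)).exists
    refine ⟨n, hn1, ?_⟩
    exact (ENNReal.div_le_iff (by simpa using (by omega : n ≠ 0)) (by simp)).1 hn.le

/-- The almost sure lower growth rate of the displacement bounds the mean progress. -/
theorem lintegral_progress_le (C : ℝ) {k N : ℕ} (hk : 1 ≤ k) {z : ℝ≥0∞}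
    (hz : ∀ᵐ ω ∂(stepMeasure μ),
      liminf (fun n : ℕ => edist o (samplePath ω (n : ℤ) • o) / (n : ℝ≥0∞)) atTop = z) :
    (∫⁻ ω, progress o C k N ω ∂(stepMeasure μ)) / (2 * k + 1 : ℕ) ≤ z := by
  refine le_of_forall_gt_imp_ge_of_dense fun r hr => ?_
  have hr0 : r ≠ 0 := (zero_le.trans_lt hr).ne'
  have hm : ∀ j : ℕ, Measurable fun ω : ℤ → G => progress o C k N (shift ((k : ℤ) * j) ω) :=
    fun j => (measurable_progress o C k N).comp (measurePreserving_shift μ _).measurable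
  have hint : ∀ j : ℕ, ∫⁻ ω, progress o C k N (shift ((k : ℤ) * j) ω) ∂(stepMeasure μ) =
      ∫⁻ ω, progress o C k N ω ∂(stepMeasure μ) := fun j =>
    (measurePreserving_shift μ _).lintegral_comp (measurable_progress o C k N)
  -- The progress sums are additive under the k-step shift, so their mean is exactly n times the
  -- mean progress. Taking ε = r in the subadditive lemma produces the factor 2k + 1.
  suffices h : ∃ n ≥ 1, ∫⁻ ω, ∑ j ∈ Finset.range n, progress o C k N (shift ((k : ℤ) * j) ω)
      ∂(stepMeasure μ) ≤ (2 * k * r + r) * (n : ℕ) by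
    obtain ⟨n, hn, hle⟩ := h
    rw [lintegral_finsetSum _ fun j _ => hm j, Finset.sum_congr rfl fun j _ => hint j,
      Finset.sum_const, Finset.card_range, nsmul_eq_mul, mul_comm] at hle
    have h1 := (ENNReal.mul_le_mul_iff_left (by simpa using (by omega : n ≠ 0)) (by simp)).1 hle
    refine ENNReal.div_le_of_le_mul (h1.trans (le_of_eq ?_))
    push_cast
    ring
  refine exists_lintegral_le_of_subadditive (measurePreserving_shift μ k)
    (Y := fun n ω => ∑ j ∈ Finset.range n, progress o C k N (shift ((k : ℤ) * j) ω))
    (fun n => Finset.measurable_fun_sum _ fun j _ => hm j)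
    (fun ω => by simp) (fun m n ω => le_of_eq ?_) ?_ ?_ hr0
  · rw [Finset.sum_range_add, shift_iterate]
    congr 1
    refine Finset.sum_congr rfl fun j _ => ?_
    congr 1
    funext i
    simp only [shift]
    congr 1
    push_cast
    ring
  -- Truncation at N provides integrability without any moment assumption.
  · refine ((lintegral_mono (g := fun _ => (N : ℝ≥0∞)) fun ω => ?_).trans_lt ?_).ne
    · simpa using progress_le o C k N _
    · simp
  · filter_upwards [hz] with ω hω
    have hfreq := frequently_lt_of_liminf_lt (by isBoundedDefault) (hω.trans_lt hr)
    obtain ⟨n, hn, hnk⟩ := (hfreq.and_eventually (eventually_ge_atTop k)).exists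
    have hJ : 1 ≤ n / k := (Nat.one_le_div_iff (by omega)).2 hnk
    refine ⟨n / k, hJ, (sum_progress_le o C k N ω _ n (Nat.mul_div_le n k)).trans ?_⟩
    have h1 := (ENNReal.div_le_iff (by simpa using (by omega : n ≠ 0)) (by simp)).1 hn.le
    refine h1.trans ?_
    -- As n ≥ k, rounding down to whole blocks loses at most a factor 2.
    have h2 : n ≤ 2 * k * (n / k) := by
      have := Nat.lt_mul_div_succ n (show 0 < k by omega)
      nlinarith
    calc r * n ≤ r * (2 * k * (n / k) : ℕ) := by gcongr
      _ = _ := by push_cast; ring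

end LimsupBound

/-! ### Comparison of the growth rate with moments -/

section Growth

variable {X : Type*} [MetricSpace X] {G : Type*} [Group G] [MulAction G X]
  [MeasurableSpace G] [DiscreteMeasurableSpace G]

theorem inv_mem_closure_atoms_map_inv {μ : Measure G} {x : G}
    (hx : x ∈ Submonoid.closure (atoms μ)) :
    x⁻¹ ∈ Submonoid.closure (atoms (μ.map (·⁻¹))) := by
  induction hx using Submonoid.closure_induction with
  | mem g hg =>
    refine Submonoid.subset_closure ?_
    have : (·⁻¹) ⁻¹' {g⁻¹} = ({g} : Set G) := by ext; simp
    rw [atoms, Set.mem_ofPred_eq, Measure.map_apply Measurable.of_discrete .of_discrete, this]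
    exact hg
  | one => simp
  | mul x y _ _ hx hy => rw [mul_inv_rev]; exact mul_mem hy hx

variable [Countable G] (μ : Measure G) [IsProbabilityMeasure μ]

theorem exists_measure_samplePath_eq_pos {β : G} (hβ : β ∈ Submonoid.closure (atoms μ)) :
    ∃ ℓ : ℕ, 0 < stepMeasure μ {ω | samplePath ω ℓ = β} := by
  obtain ⟨ℓ, hℓ⟩ := exists_measure_walk_eq_pos μ hβ
  refine ⟨ℓ, hℓ.trans_le (le_of_eq ?_)⟩
  have hm : MeasurableSet {ξ : ℕ → G | walk ξ ℓ = β} :=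
    measurable_walk ℓ (MeasurableSet.of_discrete (s := {β}))
  rw [← (measurePreserving_forward μ 0).measure_preimage hm.nullMeasurableSet]
  simp only [samplePath_natCast, Set.preimage_ofPred_eq, zero_add]

theorem lintegral_truncDist_samplePath_pos {o : X} {β : G}
    (hβ : β ∈ Submonoid.closure (atoms μ)) {C : ℝ} (hC : 0 ≤ C) (h : C < dist (β • o) o) :
    ∃ k ≥ 1, 0 < ∫⁻ ω, truncDist o C 1 (samplePath ω (k : ℕ)) ∂(stepMeasure μ) := by
  obtain ⟨ℓ, hℓ⟩ := exists_measure_samplePath_eq_pos μ hβ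
  refine ⟨ℓ, ?_, ?_⟩
  · by_contra! h0
    obtain ⟨ω, hω⟩ := nonempty_of_measure_ne_zero hℓ.ne'
    obtain rfl : ℓ = 0 := by omega
    have : (1 : G) = β := by simpa using hω
    rw [← this, one_smul, dist_self] at h
    exact h.not_ge hC
  · have hpos : 0 < truncDist o C 1 β := by simp [truncDist, h]
    refine (ENNReal.mul_pos hpos.ne' hℓ.ne').trans_le ?_
    refine le_trans ?_ (mul_meas_ge_le_lintegral (f := fun ω => truncDist o C 1 (samplePath ω ℓ))
      ((Measurable.of_discrete (f := truncDist o C 1)).comp (measurable_samplePath (ℓ : ℤ)))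
      (truncDist o C 1 β))
    gcongr
    rintro rfl
    rfl

theorem lintegral_truncDist_samplePath_one (o : X) (C : ℝ) (N : ℕ) :
    ∫⁻ ω, truncDist o C N (samplePath ω (1 : ℕ)) ∂(stepMeasure μ) =
      ∫⁻ g, truncDist o C N g ∂μ := by
  conv_rhs => rw [← map_samplePath_one μ]
  rw [lintegral_map Measurable.of_discrete (measurable_samplePath _)]

omit [Countable G] in
-- Monotone convergence removes the truncation, and subtracting the constant C cannot make an
-- infinite moment finite.
theorem iSup_lintegral_truncDist_eq_top {o : X} (h : firstMoment o μ = ∞) (C : ℝ) :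
    ⨆ N : ℕ, ∫⁻ g, truncDist o C N g ∂μ = ∞ := by
  have hmono : Monotone fun (N : ℕ) (g : G) => truncDist o C N g := fun m n hmn g =>
    min_le_min_left _ (by exact_mod_cast hmn)
  rw [← lintegral_iSup (fun N => Measurable.of_discrete) hmono]
  have hsup : ∀ g : G, ⨆ N : ℕ, truncDist o C N g = ENNReal.ofReal (dist (g • o) o - C) :=
    fun g => by simp only [truncDist]; rw [← inf_iSup_eq, ENNReal.iSup_natCast, inf_top_eq]
  simp_rw [hsup]
  by_contra hne
  refine (lt_of_le_of_lt ?_ (ENNReal.add_lt_top.2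
    ⟨lt_top_iff_ne_top.2 hne, ENNReal.ofReal_lt_top (r := C)⟩)).ne h
  calc firstMoment o μ
      ≤ ∫⁻ g, (ENNReal.ofReal (dist (g • o) o - C) + ENNReal.ofReal C) ∂μ := by
        refine lintegral_mono fun g => ?_
        rw [edist_comm, edist_dist]
        refine le_trans (ENNReal.ofReal_le_ofReal (le_of_eq ?_)) ENNReal.ofReal_add_le
        ring
    _ = _ := by
        rw [lintegral_add_right _ measurable_const, lintegral_const, measure_univ, mul_one]

variable [IsIsometricSMul G X]

/-- Under a finite first moment, the lower growth rate also bounds the upper growth rate. -/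
theorem limsup_le_of_liminf_eq (o : X) (h : firstMoment o μ < ∞) {z : ℝ≥0∞}
    (hz : ∀ᵐ ω ∂(stepMeasure μ),
      liminf (fun n : ℕ => edist o (samplePath ω (n : ℤ) • o) / (n : ℝ≥0∞)) atTop = z) :
    ∀ᵐ ω ∂(stepMeasure μ),
      limsup (fun n : ℕ => edist o (samplePath ω (n : ℤ) • o) / (n : ℝ≥0∞)) atTop ≤ z := by
  have hall : ∀ᵐ ω ∂(stepMeasure μ), ∀ m : ℕ, 1 ≤ m →
      limsup (fun n : ℕ => edist o (samplePath ω (n : ℤ) • o) / (n : ℝ≥0∞)) atTop ≤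
        (∫⁻ ω, edist o (samplePath ω (m : ℤ) • o) ∂(stepMeasure μ)) / m :=
    ae_all_iff.2 fun m => by
      by_cases hm : 1 ≤ m
      · filter_upwards [limsup_edist_div_le μ o h hm] with ω hω _ using hω
      · exact Eventually.of_forall fun ω hm' => absurd hm' hm
  filter_upwards [hall] with ω hω
  refine le_of_forall_gt_imp_ge_of_dense fun r hr => ?_
  obtain ⟨r', hr', hr'r⟩ := exists_between hr
  obtain ⟨n, hn, hle⟩ := exists_lintegral_edist_le μ o h hz hr' (tsub_pos_of_lt hr'r).ne'
  rw [add_tsub_cancel_of_le hr'r.le] at hle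
  exact (hω n hn).trans (ENNReal.div_le_of_le_mul hle)

theorem liminf_lt_top (o : X) (h : firstMoment o μ < ∞) {z : ℝ≥0∞}
    (hz : ∀ᵐ ω ∂(stepMeasure μ),
      liminf (fun n : ℕ => edist o (samplePath ω (n : ℤ) • o) / (n : ℝ≥0∞)) atTop = z) :
    z < ∞ := by
  have : IsProbabilityMeasure (stepMeasure μ) := by unfold stepMeasure; infer_instance
  obtain ⟨ω, hω, hω'⟩ := (hz.and (limsup_edist_div_le μ o h le_rfl)).exists
  rw [lintegral_edist_samplePath_one, Nat.cast_one, div_one] at hω'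
  exact (hω ▸ liminf_le_limsup).trans_lt (hω'.trans_lt h)

/-- For a non-elementary measure, truncated means of the displacement are controlled by the lower
growth rate. -/
theorem IsNonElementary.exists_mul_lintegral_truncDist_le (hX : IsGeodesicSpace X) {o : X}
    {μ : Measure G} [IsProbabilityMeasure μ] (hμ : IsNonElementary o μ) {z : ℝ≥0∞}
    (hz : ∀ᵐ ω ∂(stepMeasure μ),
      liminf (fun n : ℕ => edist o (samplePath ω (n : ℤ) • o) / (n : ℝ≥0∞)) atTop = z) :
    ∃ (C : ℝ) (δ : ℝ≥0∞), 0 ≤ C ∧ δ ≠ 0 ∧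
      (∃ β ∈ Submonoid.closure (atoms μ), C < dist (β • o) o) ∧
      ∀ k ≥ 1, ∀ N : ℕ, δ * ∫⁻ ω, truncDist o C N (samplePath ω (k : ℕ)) ∂(stepMeasure μ) ≤
        z * (2 * k + 1 : ℕ) := by
  obtain ⟨a, ha, b, hb, hca, hcb, hab⟩ := hμ
  obtain ⟨idx, Q, hS⟩ := exists_isSchottkyPair hX hca hcb hab
  have := Measure.isProbabilityMeasure_map (μ := μ)
    (Measurable.of_discrete (f := fun g : G => g⁻¹)).aemeasurable
  have hc : ∀ j : Bool, cond j a b ∈ Submonoid.closure (atoms μ) := by rintro (_ | _) <;> assumption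
  obtain ⟨C, δ, hC, hδ, hal⟩ := hS.exists_aligned μ (μ.map (·⁻¹)) hc
    fun j => inv_mem_closure_atoms_map_inv (hc j)
  refine ⟨C, δ * δ, hC, (ENNReal.mul_pos hδ.ne' hδ.ne').ne', ?_, fun k hk N => ?_⟩
  · have hQ := (hS.axis true).pos
    -- The orbit of a contracting element is a quasigeodesic, so a large power moves o by more than
    -- C.
    obtain ⟨p, hp⟩ := exists_nat_gt (Q * C + Q)
    refine ⟨a ^ p, pow_mem ha p, ?_⟩
    have h1 := (hS.axis true).abs_le_dist_orbit p
    simp only [cond_true, zpow_natCast, Int.cast_natCast, Nat.abs_cast] at h1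
    nlinarith
  · refine (mul_lintegral_le_lintegral_progress μ hal k N).trans ?_
    exact (ENNReal.div_le_iff (Nat.cast_ne_zero.2 (Nat.succ_ne_zero _))
      (ENNReal.natCast_ne_top _)).1 (lintegral_progress_le μ o C hk hz)

end Growth

end ContractingWalk

theorem theorem1p4 {X : Type*} [MetricSpace X] (hX : ContractingWalk.IsGeodesicSpace X)
    {G : Type*} [Group G] [Countable G] [MeasurableSpace G] [DiscreteMeasurableSpace G]
    [MulAction G X] [IsIsometricSMul G X] (o : X)
    (μ : Measure G) [IsProbabilityMeasure μ] (hμ : ContractingWalk.IsNonElementary o μ) :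
    ∃ lam : ℝ≥0∞, 0 < lam ∧
      (∀ᵐ g ∂(ContractingWalk.stepMeasure μ),
        Tendsto (fun n : ℕ => edist o (ContractingWalk.samplePath g (n : ℤ) • o) / (n : ℝ≥0∞))
          atTop (𝓝 lam)) ∧
      (lam < ∞ ↔ ContractingWalk.firstMoment o μ < ∞) := by
  obtain ⟨z, hz⟩ := ContractingWalk.exists_liminf_eq μ o
  obtain ⟨C, δ, hC, hδ, ⟨β, hβ, hCβ⟩, hle⟩ := hμ.exists_mul_lintegral_truncDist_le hX hz
  -- The key estimate with k = 1 and N → ∞.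
  have htop : ContractingWalk.firstMoment o μ = ∞ → z = ∞ := fun h => by
    have h1 : δ * ⨆ N : ℕ, ∫⁻ g, ContractingWalk.truncDist o C N g ∂μ ≤
        z * (2 * 1 + 1 : ℕ) := by
      rw [ENNReal.mul_iSup]
      refine iSup_le fun N => ?_
      rw [← ContractingWalk.lintegral_truncDist_samplePath_one]
      exact hle 1 le_rfl N
    rw [ContractingWalk.iSup_lintegral_truncDist_eq_top μ h, ENNReal.mul_top hδ, top_le_iff] at h1
    by_contra hz'
    exact ENNReal.mul_ne_top hz' (ENNReal.natCast_ne_top _) h1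
  refine ⟨z, ?_, ?_, ?_⟩
  -- Truncation at N = 1 is enough for positivity: if z were 0, the key estimate would annihilate a
  -- positive mean.
  · obtain ⟨k, hk, hpos⟩ := ContractingWalk.lintegral_truncDist_samplePath_pos μ hβ hC hCβ
    exact pos_of_ne_zero fun h0 => ((ENNReal.mul_pos hδ hpos.ne').trans_le (hle k hk 1)).ne'
      (by rw [h0, zero_mul])
  · have hsup : ∀ᵐ g ∂(ContractingWalk.stepMeasure μ), limsup (fun n : ℕ =>
        edist o (ContractingWalk.samplePath g (n : ℤ) • o) / (n : ℝ≥0∞)) atTop ≤ z := by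
      rcases eq_or_ne (ContractingWalk.firstMoment o μ) ∞ with h | h
      · simp [htop h]
      · exact ContractingWalk.limsup_le_of_liminf_eq μ o (lt_top_iff_ne_top.2 h) hz
    filter_upwards [hz, hsup] with ω h1 h2
    exact tendsto_of_le_liminf_of_limsup_le h1.ge h2
  · refine ⟨fun h => lt_top_iff_ne_top.2 fun h' => h.ne (htop h'),
      fun h => ContractingWalk.liminf_lt_top μ o h hz⟩
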